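/- Let $\mathbb{K}$ be a field of characteristic zero and let $\mathcal{M}$ be a finite unitary magma, i.e. a finite set with a binary operation $\star$ having a two-sided unit $\mathbb{1}_{\mathcal{M}}$ (no associativity is required). *The operad.* For $n \ge 1$, an $\mathcal{M}$-clique of arity $n$ is a map $\mathfrak{p}$ that assigns a label $\mathfrak{p}(x,y) \in \mathcal{M}$ to each arc $(x,y)$, $1 \le x < y \le n+1$, of a polygon with $n+1$ vertices; by convention the only $\mathcal{M}$-clique of arity $1$ is the one labeled by $\mathbb{1}_{\mathcal{M}}$. Its base label is $\mathfrak{p}_0 := \mathfrak{p}(1,n+1)$ and its edge labels are $\mathfrak{p}_i := \mathfrak{p}(i,i+1)$, $i \in [n]$. It is noncrossing if there are no $x < x' < y < y'$ with $\mathfrak{p}(x,y) \ne \mathbb{1}_{\mathcal{M}}$ and $\mathfrak{p}(x',y') \ne \mathbb{1}_{\mathcal{M}}$. Let $\mathrm{NC}\mathcal{M}$ be the nonsymmetric operad over $\mathbb{K}$ such that $\mathrm{NC}\mathcal{M}(n)$ is the linear span of the noncrossing $\mathcal{M}$-cliques of arity $n$, whose unit is the $\mathcal{M}$-clique of arity $1$,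 and whose partial compositions are as follows. For $\mathfrak{p}$ of arity $n$, $\mathfrak{q}$ of arity $m$ and $i \in [n]$, $\mathfrak{p} \circ_i \mathfrak{q}$ is the noncrossing $\mathcal{M}$-clique of arity $n+m-1$ obtained by gluing the base of $\mathfrak{q}$ onto the $i$th edge of $\mathfrak{p}$, labeling the common arc $(i,i+m)$ by $\mathfrak{p}_i \star \mathfrak{q}_0$, keeping the labels of all other arcs of $\mathfrak{p}$ and of $\mathfrak{q}$, and labeling all new arcs by $\mathbb{1}_{\mathcal{M}}$. *Generators and relations.* An $\mathcal{M}$-triangle is an $\mathcal{M}$-clique of arity $2$; write $[a\,|\,b,c]$ for the one with base label $a$, first edge label $b$ and second edge label $c$. Let $\mathcal{T}_{\mathcal{M}}$ be the set of all $\mathcal{M}$-triangles, $\mathrm{Free}(\mathbb{K}\langle\mathcal{T}_{\mathcal{M}}\rangle)$ the free nonsymmetric operad on its linear span (the linear span of the syntax trees on $\mathcal{T}_{\mathcal{M}}$, composed by grafting), and $\mathrm{c}(\mathfrak{p})$ the corolla labeled by $\mathfrak{p}$. Let $\mathfrak{R}_{\mathrm{NC}\mathcal{M}}$ be the subspace of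 $\mathrm{Free}(\mathbb{K}\langle\mathcal{T}_{\mathcal{M}}\rangle)(3)$ spanned by the following elements, for all $p_0,p_1,p_2,q_0,q_1,q_2,r_0,r_1,r_2 \in \mathcal{M}$: 1. $\mathrm{c}([p_0|p_1,p_2]) \circ_1 \mathrm{c}([q_0|q_1,q_2]) - \mathrm{c}([p_0|r_1,p_2]) \circ_1 \mathrm{c}([r_0|q_1,q_2])$ whenever $p_1 \star q_0 = r_1 \star r_0 \ne \mathbb{1}_{\mathcal{M}}$; 2. $\mathrm{c}([p_0|p_1,p_2]) \circ_1 \mathrm{c}([q_0|q_1,q_2]) - \mathrm{c}([p_0|q_1,r_2]) \circ_2 \mathrm{c}([r_0|q_2,p_2])$ whenever $p_1 \star q_0 = r_2 \star r_0 = \mathbb{1}_{\mathcal{M}}$; 3. $\mathrm{c}([p_0|p_1,p_2]) \circ_2 \mathrm{c}([q_0|q_1,q_2]) - \mathrm{c}([p_0|p_1,r_2]) \circ_2 \mathrm{c}([r_0|q_1,q_2])$ whenever $p_2 \star q_0 = r_2 \star r_0 \ne \mathbb{1}_{\mathcal{M}}$. **Theorem.** $\mathrm{NC}\mathcal{M}$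 admits the presentation $(\mathcal{T}_{\mathcal{M}}, \mathfrak{R}_{\mathrm{NC}\mathcal{M}})$, that is, $\mathrm{NC}\mathcal{M}$ is isomorphic, as an operad, to the quotient of $\mathrm{Free}(\mathbb{K}\langle\mathcal{T}_{\mathcal{M}}\rangle)$ by the operad ideal generated by $\mathfrak{R}_{\mathrm{NC}\mathcal{M}}$; moreover there is such an isomorphism that sends the class of $\mathrm{c}(\mathfrak{p})$ to $\mathfrak{p}$ for every $\mathcal{M}$-triangle $\mathfrak{p}$. The generators all have arity $2$ and $\mathfrak{R}_{\mathrm{NC}\mathcal{M}}$ consists of linear combinations of syntax trees with exactly two internal nodes. In particular, $\mathrm{NC}\mathcal{M}$ is binary (it has a presentation whose generators all have arity $2$) and quadratic (it has a presentation whose relations are linear combinations of syntax trees with exactly two internal nodes). -/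

import Mathlib

/-! Nonsymmetric operads are given by partial compositions. Arities are the usual ones (an element
of `obj n` has `n` inputs), but inputs, leaves and vertices are numbered from `0`: the operation
written `x ∘_i y` with `1 ≤ i ≤ n` is `comp (i - 1)`. To avoid transports between arities, the
composition takes the arity `r` of the result together with a proof of `n + m = r + 1`. -/

universe u v w

/-- A nonsymmetric set-operad, concentrated in positive arities. -/
structure NSSetOperad where
  obj : ℕ → Type u
  isEmpty_zero : IsEmpty (obj 0)
  one : obj 1
  comp : ∀ {n m r : ℕ} (i : ℕ), i < n → n + m = r + 1 → obj n → obj m → obj r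
  assoc : ∀ {n m l a b r i j : ℕ} (hi : i < n) (hj : j < m) (h₁ : n + m = a + 1)
    (h₂ : a + l = r + 1) (h₃ : m + l = b + 1) (h₄ : n + b = r + 1)
    (x : obj n) (y : obj m) (z : obj l),
    comp (i + j) (by omega) h₂ (comp i hi h₁ x y) z = comp i hi h₄ x (comp j hj h₃ y z)
  parallel : ∀ {n m l a b r i k : ℕ} (hik : i < k) (hk : k < n) (h₁ : n + m = a + 1)
    (h₂ : a + l = r + 1) (h₃ : n + l = b + 1) (h₄ : b + m = r + 1)
    (x : obj n) (y : obj m) (z : obj l),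
    comp (k + m - 1) (by omega) h₂ (comp i (by omega) h₁ x y) z =
      comp i (by omega) h₄ (comp k hk h₃ x z) y
  one_comp : ∀ {m : ℕ} (h : 1 + m = m + 1) (y : obj m), comp 0 Nat.one_pos h one y = y
  comp_one : ∀ {n i : ℕ} (hi : i < n) (x : obj n), comp i hi rfl x one = x

/-- A nonsymmetric operad in the category of vector spaces over `K`, concentrated in positive
arities. -/
structure NSOperad (K : Type w) [Field K] where
  obj : ℕ → Type v
  [addCommGroup : ∀ n, AddCommGroup (obj n)]
  [module : ∀ n, Module K (obj n)]
  subsingleton_zero : Subsingleton (obj 0)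
  one : obj 1
  comp : ∀ {n m r : ℕ} (i : ℕ), i < n → n + m = r + 1 → (obj n →ₗ[K] obj m →ₗ[K] obj r)
  assoc : ∀ {n m l a b r i j : ℕ} (hi : i < n) (hj : j < m) (h₁ : n + m = a + 1)
    (h₂ : a + l = r + 1) (h₃ : m + l = b + 1) (h₄ : n + b = r + 1)
    (x : obj n) (y : obj m) (z : obj l),
    comp (i + j) (by omega) h₂ (comp i hi h₁ x y) z = comp i hi h₄ x (comp j hj h₃ y z)
  parallel : ∀ {n m l a b r i k : ℕ} (hik : i < k) (hk : k < n) (h₁ : n + m = a + 1)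
    (h₂ : a + l = r + 1) (h₃ : n + l = b + 1) (h₄ : b + m = r + 1)
    (x : obj n) (y : obj m) (z : obj l),
    comp (k + m - 1) (by omega) h₂ (comp i (by omega) h₁ x y) z =
      comp i (by omega) h₄ (comp k hk h₃ x z) y
  one_comp : ∀ {m : ℕ} (h : 1 + m = m + 1) (y : obj m), comp 0 Nat.one_pos h one y = y
  comp_one : ∀ {n i : ℕ} (hi : i < n) (x : obj n), comp i hi rfl x one = x

attribute [instance] NSOperad.addCommGroup NSOperad.module

/-- The bilinear extension of a partial composition of a set-operad. -/
noncomputable def NSSetOperad.linComp (K : Type w) [Field K] (X : NSSetOperad.{u}) {n m r : ℕ}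
    (i : ℕ) (hi : i < n) (h : n + m = r + 1) :
    (X.obj n →₀ K) →ₗ[K] (X.obj m →₀ K) →ₗ[K] (X.obj r →₀ K) :=
  Finsupp.linearCombination K (fun x => Finsupp.lmapDomain K K (X.comp i hi h x))

theorem NSSetOperad.linComp_single (K : Type w) [Field K] (X : NSSetOperad.{u}) {n m r : ℕ}
    (i : ℕ) (hi : i < n) (h : n + m = r + 1) (x : X.obj n) (y : X.obj m) (a b : K) :
    X.linComp K i hi h (Finsupp.single x a) (Finsupp.single y b) =
      Finsupp.single (X.comp i hi h x y) (a * b) := by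
  rw [linComp, Finsupp.linearCombination_single, LinearMap.smul_apply,
    Finsupp.lmapDomain_apply, Finsupp.mapDomain_single, Finsupp.smul_single, smul_eq_mul]

/-- The operad whose space in arity `n` is the linear span of `X.obj n`, with the bilinear
extension of the partial compositions of `X`. -/
noncomputable def NSSetOperad.linearize (K : Type w) [Field K] (X : NSSetOperad.{u}) :
    NSOperad.{max u w} K where
  obj n := X.obj n →₀ K
  subsingleton_zero := by
    have := X.isEmpty_zero
    infer_instance
  one := Finsupp.single X.one 1
  comp i hi h := X.linComp K i hi h
  assoc hi hj h₁ h₂ h₃ h₄ x y z := by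
    induction x using Finsupp.induction_linear with
    | zero => simp only [map_zero, LinearMap.zero_apply]
    | add f g hf hg => simp only [map_add, LinearMap.add_apply, hf, hg]
    | single x a =>
    induction y using Finsupp.induction_linear with
    | zero => simp only [map_zero, LinearMap.zero_apply]
    | add f g hf hg => simp only [map_add, LinearMap.add_apply, hf, hg]
    | single y b =>
    induction z using Finsupp.induction_linear with
    | zero => simp only [map_zero]
    | add f g hf hg => simp only [map_add, hf, hg]
    | single z c => simp only [linComp_single, X.assoc hi hj h₁ h₂ h₃ h₄, mul_assoc]
  parallel hik hk h₁ h₂ h₃ h₄ x y z := by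
    induction x using Finsupp.induction_linear with
    | zero => simp only [map_zero, LinearMap.zero_apply]
    | add f g hf hg => simp only [map_add, LinearMap.add_apply, hf, hg]
    | single x a =>
    induction y using Finsupp.induction_linear with
    | zero => simp only [map_zero, LinearMap.zero_apply]
    | add f g hf hg => simp only [map_add, LinearMap.add_apply, hf, hg]
    | single y b =>
    induction z using Finsupp.induction_linear with
    | zero => simp only [map_zero, LinearMap.zero_apply]
    | add f g hf hg => simp only [map_add, LinearMap.add_apply, hf, hg]
    | single z c =>
      simp only [linComp_single, X.parallel hik hk h₁ h₂ h₃ h₄, mul_right_comm]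
  one_comp h y := by
    induction y using Finsupp.induction_linear with
    | zero => simp only [map_zero]
    | add f g hf hg => simp only [map_add, hf, hg]
    | single y b => simp only [linComp_single, X.one_comp, one_mul]
  comp_one hi x := by
    induction x using Finsupp.induction_linear with
    | zero => simp only [map_zero, LinearMap.zero_apply]
    | add f g hf hg => simp only [map_add, LinearMap.add_apply, hf, hg]
    | single x a => simp only [linComp_single, X.comp_one, mul_one]

namespace NSOperad

variable {K : Type w} [Field K]

/-- An isomorphism of operads. -/
structure Iso (O : NSOperad.{u} K) (P : NSOperad.{v} K) where
  equiv : ∀ n, O.obj n ≃ₗ[K] P.obj n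
  map_one : equiv 1 O.one = P.one
  map_comp : ∀ {n m r : ℕ} (i : ℕ) (hi : i < n) (h : n + m = r + 1) (x : O.obj n) (y : O.obj m),
    equiv r (O.comp i hi h x y) = P.comp i hi h (equiv n x) (equiv m y)

/-- An operad ideal. -/
structure Ideal (O : NSOperad.{u} K) where
  carrier : ∀ n, Submodule K (O.obj n)
  comp_mem_left : ∀ {n m r : ℕ} (i : ℕ) (hi : i < n) (h : n + m = r + 1)
    (x : O.obj n) (y : O.obj m), x ∈ carrier n → O.comp i hi h x y ∈ carrier r
  comp_mem_right : ∀ {n m r : ℕ} (i : ℕ) (hi : i < n) (h : n + m = r + 1)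
    (x : O.obj n) (y : O.obj m), y ∈ carrier m → O.comp i hi h x y ∈ carrier r

/-- The smallest operad ideal containing the graded subspace `R`. -/
def Ideal.span {O : NSOperad.{u} K} (R : ∀ n, Submodule K (O.obj n)) : O.Ideal where
  carrier n := ⨅ (I : O.Ideal) (_ : ∀ k, R k ≤ I.carrier k), I.carrier n
  comp_mem_left i hi h x y hx := by
    simp only [Submodule.mem_iInf] at hx ⊢
    exact fun I hI => I.comp_mem_left i hi h x y (hx I hI)
  comp_mem_right i hi h x y hy := by
    simp only [Submodule.mem_iInf] at hy ⊢
    exact fun I hI => I.comp_mem_right i hi h x y (hy I hI)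

/-- The partial composition induced on the quotient by an ideal: the composition of the classes of
`x` and `y` is the class of the composition of `x` and `y`. -/
def quotientComp (O : NSOperad.{u} K) (I : O.Ideal) {n m r : ℕ} (i : ℕ) (hi : i < n)
    (h : n + m = r + 1) :
    (O.obj n ⧸ I.carrier n) →ₗ[K] (O.obj m ⧸ I.carrier m) →ₗ[K] (O.obj r ⧸ I.carrier r) :=
  (I.carrier n).liftQ
    ((Submodule.mapQLinear (I.carrier m) (I.carrier r)).comp
      ((O.comp i hi h).codRestrict (Submodule.compatibleMaps (I.carrier m) (I.carrier r))
        (fun x y hy => I.comp_mem_right i hi h x y hy)))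
    (fun x hx => by
      rw [LinearMap.mem_ker]
      refine Submodule.linearMap_qext _ (LinearMap.ext fun y => ?_)
      exact (Submodule.Quotient.mk_eq_zero _).2 (I.comp_mem_left i hi h x y hx))

theorem quotientComp_mk (O : NSOperad.{u} K) (I : O.Ideal) {n m r : ℕ} (i : ℕ) (hi : i < n)
    (h : n + m = r + 1) (x : O.obj n) (y : O.obj m) :
    O.quotientComp I i hi h (Submodule.Quotient.mk x) (Submodule.Quotient.mk y) =
      Submodule.Quotient.mk (O.comp i hi h x y) := rfl

/-- The quotient of an operad by an operad ideal. -/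
def quotient (O : NSOperad.{u} K) (I : O.Ideal) : NSOperad.{u} K where
  obj n := O.obj n ⧸ I.carrier n
  subsingleton_zero := by
    have := O.subsingleton_zero
    exact (Submodule.Quotient.mk_surjective (I.carrier 0)).subsingleton
  one := Submodule.Quotient.mk O.one
  comp i hi h := O.quotientComp I i hi h
  assoc hi hj h₁ h₂ h₃ h₄ x y z := by
    obtain ⟨x, rfl⟩ := Submodule.Quotient.mk_surjective _ x
    obtain ⟨y, rfl⟩ := Submodule.Quotient.mk_surjective _ y
    obtain ⟨z, rfl⟩ := Submodule.Quotient.mk_surjective _ z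
    simp only [quotientComp_mk, O.assoc hi hj h₁ h₂ h₃ h₄ x y z]
  parallel hik hk h₁ h₂ h₃ h₄ x y z := by
    obtain ⟨x, rfl⟩ := Submodule.Quotient.mk_surjective _ x
    obtain ⟨y, rfl⟩ := Submodule.Quotient.mk_surjective _ y
    obtain ⟨z, rfl⟩ := Submodule.Quotient.mk_surjective _ z
    simp only [quotientComp_mk, O.parallel hik hk h₁ h₂ h₃ h₄ x y z]
  one_comp h y := by
    obtain ⟨y, rfl⟩ := Submodule.Quotient.mk_surjective _ y
    simp only [quotientComp_mk, O.one_comp h y]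
  comp_one hi x := by
    obtain ⟨x, rfl⟩ := Submodule.Quotient.mk_surjective _ x
    simp only [quotientComp_mk, O.comp_one hi x]

/-- The class of an element in the quotient operad. -/
def toQuotient {O : NSOperad.{u} K} (I : O.Ideal) {n : ℕ} (x : O.obj n) :
    (O.quotient I).obj n :=
  Submodule.Quotient.mk (p := I.carrier n) x

end NSOperad

/-- Syntax trees on the graded set `G` (the elements of `G n` have arity `n`; an internal node with
`k > 0` children is labeled by an element of `G k`, so `G 0` plays no role). -/
inductive SyntaxTree (G : ℕ → Type u) : Type u
  | leaf : SyntaxTree G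
  | node (k : ℕ) (hk : 0 < k) (g : G k) (children : Fin k → SyntaxTree G) : SyntaxTree G

namespace SyntaxTree

variable {G : ℕ → Type u}

/-- The number of leaves. -/
def arity : SyntaxTree G → ℕ
  | leaf => 1
  | node _ _ _ c => ∑ a, (c a).arity

/-- The number of internal nodes. -/
def degree : SyntaxTree G → ℕ
  | leaf => 0
  | node _ _ _ c => 1 + ∑ a, (c a).degree

/-- The sum of the values of `w` at the indices smaller than `a`. -/
def offset {k : ℕ} (w : Fin k → ℕ) (a : ℕ) : ℕ := 
  ∑ b ∈ Finset.univ.filter (fun b : Fin k => (b : ℕ) < a), w b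

/-- The tree obtained by grafting, for each `j`, the root of `f j` on the `j`th leaf. -/
def subst : SyntaxTree G → (ℕ → SyntaxTree G) → SyntaxTree G
  | leaf, f => f 0
  | node k hk g c, f =>
      node k hk g (fun a => (c a).subst (fun j => f (offset (fun b => (c b).arity) a + j)))

/-- The tree obtained by grafting the root of `t` on the `i`th leaf of `s`. -/
def graft (s : SyntaxTree G) (i : ℕ) (t : SyntaxTree G) : SyntaxTree G :=
  s.subst (fun j => if j = i then t else leaf)

theorem offset_zero {k : ℕ} (w : Fin k → ℕ) : offset w 0 = 0 := by simp [offset]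

theorem offset_succ {k : ℕ} (w : Fin k → ℕ) (a : Fin k) :
    offset w (a + 1) = offset w a + w a := by
  have : (Finset.univ.filter fun b : Fin k => (b : ℕ) < a + 1) =
      insert a (Finset.univ.filter fun b : Fin k => (b : ℕ) < a) := by
    ext b
    simp [Fin.ext_iff]
    omega
  rw [offset, this, Finset.sum_insert (by simp), add_comm, offset]

theorem offset_top {k : ℕ} (w : Fin k → ℕ) : offset w k = ∑ a, w a := by
  simp [offset]

theorem offset_sum {k : ℕ} (w : Fin k → ℕ) (f : ℕ → ℕ) (a : ℕ) (ha : a ≤ k) :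
    offset (fun b => ∑ j ∈ Finset.range (w b), f (offset w b + j)) a =
      ∑ j ∈ Finset.range (offset w a), f j := by
  induction a with
  | zero => simp [offset_zero]
  | succ a ih =>
    have h1 := offset_succ w ⟨a, ha⟩
    have h2 := offset_succ (fun b => ∑ j ∈ Finset.range (w b), f (offset w b + j)) ⟨a, ha⟩
    simp only at h1 h2
    rw [h2, h1, Finset.sum_range_add, ih (by omega)]

theorem offset_add_lt {k : ℕ} (w : Fin k → ℕ) (a : Fin k) (j : ℕ) (hj : j < w a) :
    offset w a + j < ∑ b, w b := by
  have h : offset w (a + 1) ≤ ∑ b, w b :=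
    Finset.sum_le_sum_of_subset (Finset.filter_subset _ _)
  rw [offset_succ] at h
  omega

theorem arity_pos (t : SyntaxTree G) : 0 < t.arity := by
  induction t with
  | leaf => simp [arity]
  | node k hk g c ih => exact Finset.sum_pos (fun a _ => ih a) ⟨⟨0, hk⟩, Finset.mem_univ _⟩

theorem arity_subst (s : SyntaxTree G) (f : ℕ → SyntaxTree G) :
    (s.subst f).arity = ∑ j ∈ Finset.range s.arity, (f j).arity := by
  induction s generalizing f with
  | leaf => simp [subst, arity]
  | node k hk g c ih =>
    simp only [subst, arity, ih]
    rw [← offset_top, offset_sum (fun b => (c b).arity) (fun j => (f j).arity) _ le_rfl,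
      offset_top]

theorem subst_congr (s : SyntaxTree G) {f f' : ℕ → SyntaxTree G}
    (h : ∀ j < s.arity, f j = f' j) : s.subst f = s.subst f' := by
  induction s generalizing f f' with
  | leaf => exact h 0 (by simp [arity])
  | node k hk g c ih =>
    simp only [subst]
    congr 1
    funext a
    exact ih a fun j hj => h _ (offset_add_lt (fun b => (c b).arity) a j hj)

theorem subst_subst (s : SyntaxTree G) (f f' : ℕ → SyntaxTree G) :
    (s.subst f).subst f' = s.subst (fun j => (f j).subst
      (fun l => f' ((∑ i ∈ Finset.range j, (f i).arity) + l))) := by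
  induction s generalizing f f' with
  | leaf => simp [subst]
  | node k hk g c ih =>
    simp only [subst, ih, arity_subst]
    congr 1
    funext a
    congr 1
    funext j
    congr 1
    funext l
    rw [offset_sum (fun b => (c b).arity) (fun j => (f j).arity) _ (by omega),
      Finset.sum_range_add, add_assoc]

theorem subst_leaf (s : SyntaxTree G) : s.subst (fun _ => leaf) = s := by
  induction s with
  | leaf => rfl
  | node k hk g c ih => simp only [subst, ih]

theorem sum_arity_ite (i : ℕ) (t : SyntaxTree G) (j : ℕ) :
    (∑ l ∈ Finset.range j, (if l = i then t else leaf : SyntaxTree G).arity) =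
      if i < j then j + t.arity - 1 else j := by
  have ht := t.arity_pos
  induction j with
  | zero => simp
  | succ j ih =>
    rw [Finset.sum_range_succ, ih]
    have hl : (leaf : SyntaxTree G).arity = 1 := rfl
    split_ifs <;> omega

theorem arity_graft {s : SyntaxTree G} {i : ℕ} (hi : i < s.arity) (t : SyntaxTree G) :
    (s.graft i t).arity = s.arity + t.arity - 1 := by
  rw [graft, arity_subst, sum_arity_ite, if_pos hi]

theorem graft_assoc (s t u : SyntaxTree G) {i j : ℕ} (hj : j < t.arity) :
    (s.graft i t).graft (i + j) u = s.graft i (t.graft j u) := by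
  rw [graft, graft, subst_subst, graft]
  apply subst_congr
  intro l _
  rw [sum_arity_ite]
  by_cases h : l = i
  · subst h
    simp [graft]
  · rw [if_neg h, if_neg h, subst, if_neg]
    split_ifs <;> omega

theorem graft_parallel (s t u : SyntaxTree G) {i k : ℕ} (hik : i < k) :
    (s.graft i t).graft (k + t.arity - 1) u = (s.graft k u).graft i t := by
  have ht := t.arity_pos
  have hu := u.arity_pos
  rw [graft, graft, subst_subst, graft, graft, subst_subst]
  apply subst_congr
  intro l _
  rw [sum_arity_ite, sum_arity_ite]
  by_cases h : l = i
  · subst h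
    rw [if_pos rfl, if_neg (by omega), if_neg (by omega), if_neg (by omega), subst,
      if_pos (by omega)]
    conv_rhs => rw [← subst_leaf t]
    apply subst_congr
    intro a ha
    rw [if_neg (by omega)]
  by_cases h' : l = k
  · subst h'
    rw [if_neg h, if_pos rfl, if_pos hik, if_neg (by omega), subst, if_pos (by omega)]
    conv_lhs => rw [← subst_leaf u]
    apply subst_congr
    intro a ha
    rw [if_neg (by omega)]
  · rw [if_neg h, if_neg h', subst, subst, if_neg, if_neg] <;> split_ifs <;> omega

/-- The set-operad of syntax trees on `G`. -/
def setOperad (G : ℕ → Type u) : NSSetOperad.{u} where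
  obj n := {t : SyntaxTree G // t.arity = n}
  isEmpty_zero := ⟨fun t => by have := t.1.arity_pos; have := t.2; omega⟩
  one := ⟨leaf, rfl⟩
  comp i hi h s t := ⟨s.1.graft i t.1, by
    rw [arity_graft (by rw [s.2]; exact hi), s.2, t.2]; omega⟩
  assoc hi hj h₁ h₂ h₃ h₄ x y z := Subtype.ext (graft_assoc _ _ _ (by rw [y.2]; exact hj))
  parallel hik hk h₁ h₂ h₃ h₄ x y z := by
    apply Subtype.ext
    have := graft_parallel x.1 y.1 z.1 hik
    rw [y.2] at this
    exact this
  one_comp h y := rfl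
  comp_one hi x := Subtype.ext (by simp [graft, subst_leaf])

/-- The corolla labeled by `g`. -/
def corolla {n : ℕ} (hn : 0 < n) (g : G n) : SyntaxTree G := node n hn g (fun _ => leaf)

theorem arity_corolla {n : ℕ} (hn : 0 < n) (g : G n) : (corolla hn g).arity = n := by
  simp [corolla, arity]

end SyntaxTree

/-- The free operad on the linear span of the graded set `G`: in arity `n`, the linear span of the
syntax trees on `G` with `n` leaves, composed by grafting. -/
noncomputable def freeOperad (K : Type w) [Field K] (G : ℕ → Type u) : NSOperad.{max u w} K :=
  (SyntaxTree.setOperad G).linearize K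

/-- A syntax tree of arity `n` as an element of the free operad. -/
noncomputable def freeOperad.ofTree (K : Type w) [Field K] {G : ℕ → Type u} {n : ℕ}
    (t : SyntaxTree G) (ht : t.arity = n) : (freeOperad K G).obj n :=
  Finsupp.single (⟨t, ht⟩ : {t : SyntaxTree G // t.arity = n}) (1 : K)

/-- The inclusion `c` of the generators (as corollas) in the free operad. -/
noncomputable def freeOperad.c (K : Type w) [Field K] {G : ℕ → Type u} {n : ℕ} (hn : 0 < n)
    (g : G n) : (freeOperad K G).obj n :=
  freeOperad.ofTree K (SyntaxTree.corolla hn g) (SyntaxTree.arity_corolla hn g)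

namespace NSOperad

variable {K : Type w} [Field K]

/-- `(G, R)` is a presentation of `O`. -/
def IsPresentation (O : NSOperad.{v} K) (G : ℕ → Type u)
    (R : ∀ n, Submodule K ((freeOperad K G).obj n)) : Prop :=
  Nonempty (Iso ((freeOperad K G).quotient (Ideal.span R)) O)

/-- The operad `O` has a presentation all of whose generators have arity `2`. -/
def IsBinary (O : NSOperad.{v} K) : Prop :=
  ∃ (G : ℕ → Type u) (R : ∀ n, Submodule K ((freeOperad K G).obj n)),
    O.IsPresentation G R ∧ ∀ n, n ≠ 2 → IsEmpty (G n)

/-- The graded subspace `R` of the free operad consists of linear combinations of syntax trees of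
degree `2`. -/
def IsQuadraticSpace {G : ℕ → Type u} (R : ∀ n, Submodule K ((freeOperad K G).obj n)) : Prop :=
  ∀ n, R n ≤ Submodule.span K
    {x | ∃ (t : SyntaxTree G) (ht : t.arity = n), t.degree = 2 ∧ x = freeOperad.ofTree K t ht}

/-- The operad `O` has a presentation whose relations are quadratic. -/
def IsQuadratic (O : NSOperad.{v} K) : Prop :=
  ∃ (G : ℕ → Type u) (R : ∀ n, Submodule K ((freeOperad K G).obj n)),
    O.IsPresentation G R ∧ IsQuadraticSpace R

end NSOperad

/-- The arcs `(fst, snd)` of the polygon with vertices `0, …, n`. -/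
@[ext]
structure Arc (n : ℕ) where
  fst : ℕ
  snd : ℕ
  lt : fst < snd
  le : snd ≤ n

/-- `M`-cliques of arity `n ≥ 1`: each arc of the polygon with `n + 1` vertices has a label in the
unitary magma `M`. By convention the only `M`-clique of arity `1` is the one labeled by the
unit. -/
@[ext]
structure Clique (M : Type u) [MulOneClass M] (n : ℕ) where
  label : Arc n → M
  pos : 1 ≤ n
  unit_label : n = 1 → ∀ a, label a = 1

namespace Clique

variable {M : Type u} [MulOneClass M] {n m l r : ℕ}

/-- The label of the arc `(x, y)`, set to `1` if this is not an arc. -/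
def lab (p : Clique M n) (x y : ℕ) : M :=
  if h : x < y ∧ y ≤ n then p.label ⟨x, y, h.1, h.2⟩ else 1

/-- The partial composition of `M`-cliques: the base `(0, m)` of `q` is glued on the edge
`(i, i + 1)` of `p`, and the resulting common arc `(i, i + m)` is labeled by the product of their
labels. -/
def comp (i : ℕ) (h : n + m = r + 1) (p : Clique M n) (q : Clique M m) : Clique M r where
  label a :=
    if a.fst = i ∧ a.snd = i + m then p.lab i (i + 1) * q.lab 0 m
    else if a.snd ≤ i then p.lab a.fst a.snd
    else if i + m ≤ a.fst then p.lab (a.fst + 1 - m) (a.snd + 1 - m)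
    else if i ≤ a.fst ∧ a.snd ≤ i + m then q.lab (a.fst - i) (a.snd - i)
    else if a.fst ≤ i ∧ i + m ≤ a.snd then p.lab a.fst (a.snd + 1 - m)
    else 1
  pos := by have := p.pos; have := q.pos; omega
  unit_label hr a := by
    have hp := p.pos
    have hq := q.pos
    have hn : n = 1 := by omega
    have hm : m = 1 := by omega
    have h1 : ∀ x y, p.lab x y = 1 := fun x y => by
      unfold lab; split_ifs
      exacts [p.unit_label hn _, rfl]
    have h2 : ∀ x y, q.lab x y = 1 := fun x y => by
      unfold lab; split_ifs
      exacts [q.unit_label hm _, rfl]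
    simp [h1, h2]

/-- No two solid diagonals cross. (Crossing arcs are always diagonals.) -/
def Noncrossing (p : Clique M n) : Prop :=
  ∀ a b : Arc n, a.fst < b.fst → b.fst < a.snd → a.snd < b.snd → p.label a = 1 ∨ p.label b = 1

/-- The `M`-clique of arity `1`. -/
def unit : Clique M 1 where
  label _ := 1
  pos := le_rfl
  unit_label _ _ := rfl

theorem label_eq (p : Clique M n) (a : Arc n) : p.label a = p.lab a.fst a.snd := by
  rw [lab, dif_pos ⟨a.lt, a.le⟩]

theorem lab_ext {p q : Clique M n} (h : ∀ x y, x < y → y ≤ n → p.lab x y = q.lab x y) : p = q := by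
  ext a
  rw [label_eq, label_eq, h _ _ a.lt a.le]

theorem lab_comp (i : ℕ) (h : n + m = r + 1) (p : Clique M n) (q : Clique M m) {x y : ℕ}
    (hxy : x < y) (hy : y ≤ r) : (comp i h p q).lab x y =
    if x = i ∧ y = i + m then p.lab i (i + 1) * q.lab 0 m
    else if y ≤ i then p.lab x y
    else if i + m ≤ x then p.lab (x + 1 - m) (y + 1 - m)
    else if i ≤ x ∧ y ≤ i + m then q.lab (x - i) (y - i)
    else if x ≤ i ∧ i + m ≤ y then p.lab x (y + 1 - m)
    else 1 := by
  rw [lab, dif_pos ⟨hxy, hy⟩]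
  rfl

theorem lab_unit (x y : ℕ) : (unit : Clique M 1).lab x y = 1 := by
  unfold lab unit; split_ifs <;> rfl

theorem lab_of_one (p : Clique M n) (h : n = 1) (x y : ℕ) : p.lab x y = 1 := by
  unfold lab; split_ifs
  exacts [p.unit_label h _, rfl]

theorem lab_congr (p : Clique M n) {x y x' y' : ℕ} (hx : x = x') (hy : y = y') :
    p.lab x y = p.lab x' y' := by rw [hx, hy]

theorem lab_comp_mid {i : ℕ} (h : n + m = r + 1) (p : Clique M n) (q : Clique M m)
    {x y : ℕ} (hxy : x < y) (hy : y ≤ r) (hx : x = i ∧ y = i + m) :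
    (comp i h p q).lab x y = p.lab i (i + 1) * q.lab 0 m := by
  rw [lab_comp _ _ _ _ hxy hy, if_pos hx]

theorem lab_comp_left {i : ℕ} (h : n + m = r + 1) (p : Clique M n) (q : Clique M m)
    {x y : ℕ} (hxy : x < y) (hy : y ≤ r) (hx : y ≤ i) : (comp i h p q).lab x y = p.lab x y := by
  rw [lab_comp _ _ _ _ hxy hy, if_neg (by omega), if_pos hx]

theorem lab_comp_right {i : ℕ} (h : n + m = r + 1) (p : Clique M n) (q : Clique M m)
    {x y : ℕ} (hxy : x < y) (hy : y ≤ r) (hx : i + m ≤ x) :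
    (comp i h p q).lab x y = p.lab (x + 1 - m) (y + 1 - m) := by
  have := q.pos
  rw [lab_comp _ _ _ _ hxy hy, if_neg (by omega), if_neg (by omega), if_pos hx]

theorem lab_comp_in {i : ℕ} (h : n + m = r + 1) (p : Clique M n) (q : Clique M m)
    {x y : ℕ} (hxy : x < y) (hy : y ≤ r) (hx : i ≤ x ∧ y ≤ i + m ∧ ¬(x = i ∧ y = i + m)) :
    (comp i h p q).lab x y = q.lab (x - i) (y - i) := by
  rw [lab_comp _ _ _ _ hxy hy, if_neg (by omega), if_neg (by omega), if_neg (by omega),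
    if_pos (by omega)]

theorem lab_comp_out {i : ℕ} (h : n + m = r + 1) (p : Clique M n) (q : Clique M m)
    {x y : ℕ} (hxy : x < y) (hy : y ≤ r) (hx : x ≤ i ∧ i + m ≤ y ∧ ¬(x = i ∧ y = i + m)) :
    (comp i h p q).lab x y = p.lab x (y + 1 - m) := by
  have := q.pos
  rw [lab_comp _ _ _ _ hxy hy, if_neg (by omega), if_neg (by omega), if_neg (by omega),
    if_neg (by omega), if_pos (by omega)]

theorem lab_comp_else {i : ℕ} (h : n + m = r + 1) (p : Clique M n) (q : Clique M m)
    {x y : ℕ} (hxy : x < y) (hy : y ≤ r) (hx : (x < i ∧ i < y ∧ y < i + m) ∨ (i < x ∧ x < i + m ∧ i + m < y)) :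
    (comp i h p q).lab x y = 1 := by
  rw [lab_comp _ _ _ _ hxy hy, if_neg (by omega), if_neg (by omega), if_neg (by omega),
    if_neg (by omega), if_neg (by omega)]

theorem comp_unit {i : ℕ} (h : n + 1 = n + 1) (p : Clique M n) (q : Clique M 1) :
    comp i h p q = p := by
  apply lab_ext
  intro x y hxy hy
  rw [lab_comp _ _ _ _ hxy hy]
  simp only [q.lab_of_one rfl, mul_one]
  split_ifs <;> first | (exfalso; omega) | exact lab_congr _ (by omega) (by omega)

theorem unit_comp (h : 1 + m = m + 1) (p : Clique M 1) (q : Clique M m) :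
    comp 0 h p q = q := by
  apply lab_ext
  intro x y hxy hy
  rw [lab_comp _ _ _ _ hxy hy]
  simp only [p.lab_of_one rfl, one_mul]
  split_ifs <;> first | (exfalso; omega) | exact lab_congr _ (by omega) (by omega)

theorem comp_assoc {a b i j : ℕ} (hi : i < n) (hj : j < m) (h₁ : n + m = a + 1)
    (h₂ : a + l = r + 1) (h₃ : m + l = b + 1) (h₄ : n + b = r + 1)
    (p : Clique M n) (q : Clique M m) (s : Clique M l) :
    comp (i + j) h₂ (comp i h₁ p q) s = comp i h₄ p (comp j h₃ q s) := by
  have hn := p.pos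
  have hm := q.pos
  have hl := s.pos
  by_cases hm1 : m = 1
  · subst hm1
    obtain rfl : a = n := by omega
    obtain rfl : b = l := by omega
    obtain rfl : j = 0 := by omega
    rw [comp_unit, unit_comp, add_zero]
  apply lab_ext
  intro x y hxy hy
  rw [lab_comp _ _ _ _ hxy hy, lab_comp _ _ _ _ hxy hy]
  split_ifs
  all_goals try (exfalso; omega)
  all_goals repeat first
    | rw [lab_comp_left _ _ _ (by omega) (by omega) (by omega)]
    | rw [lab_comp_right _ _ _ (by omega) (by omega) (by omega)]
    | rw [lab_comp_in _ _ _ (by omega) (by omega) (by omega)]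
    | rw [lab_comp_out _ _ _ (by omega) (by omega) (by omega)]
    | rw [lab_comp_mid _ _ _ (by omega) (by omega) (by omega)]
    | rw [lab_comp_else _ _ _ (by omega) (by omega) (by omega)]
  all_goals first
    | rfl
    | exact lab_congr _ (by omega) (by omega)
    | exact congrArg₂ (· * ·) (lab_congr _ (by omega) (by omega)) (lab_congr _ (by omega) (by omega))

theorem comp_parallel {a b i k : ℕ} (hik : i < k) (hk : k < n) (h₁ : n + m = a + 1)
    (h₂ : a + l = r + 1) (h₃ : n + l = b + 1) (h₄ : b + m = r + 1)
    (p : Clique M n) (q : Clique M m) (s : Clique M l) :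
    comp (k + m - 1) h₂ (comp i h₁ p q) s = comp i h₄ (comp k h₃ p s) q := by
  have hn := p.pos
  have hm := q.pos
  have hl := s.pos
  apply lab_ext
  intro x y hxy hy
  rw [lab_comp _ _ _ _ hxy hy, lab_comp _ _ _ _ hxy hy]
  split_ifs
  all_goals try (exfalso; omega)
  all_goals repeat first
    | rw [lab_comp_left _ _ _ (by omega) (by omega) (by omega)]
    | rw [lab_comp_right _ _ _ (by omega) (by omega) (by omega)]
    | rw [lab_comp_in _ _ _ (by omega) (by omega) (by omega)]
    | rw [lab_comp_out _ _ _ (by omega) (by omega) (by omega)]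
    | rw [lab_comp_mid _ _ _ (by omega) (by omega) (by omega)]
    | rw [lab_comp_else _ _ _ (by omega) (by omega) (by omega)]
  all_goals first
    | rfl
    | exact lab_congr _ (by omega) (by omega)
    | exact congrArg₂ (· * ·) (lab_congr _ (by omega) (by omega)) (lab_congr _ (by omega) (by omega))

theorem noncrossing_iff (p : Clique M n) : p.Noncrossing ↔ ∀ x y x' y' : ℕ, x < x' → x' < y →
    y < y' → y' ≤ n → p.lab x y = 1 ∨ p.lab x' y' = 1 := by
  constructor
  · intro h x y x' y' h1 h2 h3 h4
    have := h ⟨x, y, by omega, by omega⟩ ⟨x', y', by omega, h4⟩ h1 h2 h3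
    rwa [label_eq, label_eq] at this
  · intro h a b h1 h2 h3
    rw [label_eq, label_eq]
    exact h _ _ _ _ h1 h2 h3 b.le

theorem Noncrossing.comp {i : ℕ} (hi : i < n) (h : n + m = r + 1) {p : Clique M n}
    {q : Clique M m} (hp : p.Noncrossing) (hq : q.Noncrossing) : (comp i h p q).Noncrossing := by
  have hm := q.pos
  rw [noncrossing_iff] at hp hq ⊢
  intro x y x' y' h1 h2 h3 h4
  rw [lab_comp _ _ _ _ (by omega) (by omega), lab_comp _ _ _ _ (by omega) (by omega)]
  split_ifs
  all_goals first
    | (exfalso; omega)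
    | exact Or.inl rfl
    | exact Or.inr rfl
    | exact hp _ _ _ _ (by omega) (by omega) (by omega) (by omega)
    | exact hq _ _ _ _ (by omega) (by omega) (by omega) (by omega)

end Clique

/-- The set-operad of noncrossing `M`-cliques. -/
def noncrossingSetOperad (M : Type u) [MulOneClass M] : NSSetOperad.{u} where
  obj n := {p : Clique M n // p.Noncrossing}
  isEmpty_zero := ⟨fun p => absurd p.1.pos (by omega)⟩
  one := ⟨Clique.unit, fun a b h₁ h₂ h₃ => Or.inl rfl⟩
  comp i hi h p q := ⟨Clique.comp i h p.1 q.1, p.2.comp hi h q.2⟩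
  assoc hi hj h₁ h₂ h₃ h₄ p q s := Subtype.ext (Clique.comp_assoc hi hj h₁ h₂ h₃ h₄ p.1 q.1 s.1)
  parallel hik hk h₁ h₂ h₃ h₄ p q s :=
    Subtype.ext (Clique.comp_parallel hik hk h₁ h₂ h₃ h₄ p.1 q.1 s.1)
  one_comp h q := Subtype.ext (Clique.unit_comp h _ q.1)
  comp_one hi p := Subtype.ext (Clique.comp_unit rfl p.1 _)

/-- The noncrossing `M`-clique operad `NC M` over the field `K`. -/
noncomputable def NC (K : Type w) [Field K] (M : Type u) [MulOneClass M] : NSOperad.{max u w} K :=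
  (noncrossingSetOperad M).linearize K

/-- A noncrossing `M`-clique as an element of the fundamental basis of `NC M`. -/
noncomputable def NC.basis (K : Type w) [Field K] {M : Type u} [MulOneClass M] {n : ℕ}
    (p : Clique M n) (hp : p.Noncrossing) : (NC K M).obj n :=
  Finsupp.single (⟨p, hp⟩ : {p : Clique M n // p.Noncrossing}) (1 : K)

/-- The graded set of `M`-triangles, that is, of `M`-cliques of arity `2`. -/
def Triangles (M : Type u) [MulOneClass M] (n : ℕ) : Type u := {_p : Clique M n // n = 2}

theorem Clique.noncrossing_of_arity_two {M : Type u} [MulOneClass M] (p : Clique M 2) :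
    p.Noncrossing :=
  fun a b h₁ h₂ h₃ => absurd b.le (by omega)

/-- The `M`-triangle with base `(0, 2)` labeled by `p₀`, first edge `(0, 1)` labeled by `p₁` and
second edge `(1, 2)` labeled by `p₂`. -/
def triangle {M : Type u} [MulOneClass M] (p₀ p₁ p₂ : M) : Triangles M 2 :=
  ⟨{ label := fun a => if a.fst = 0 ∧ a.snd = 2 then p₀ else if a.fst = 0 then p₁ else p₂
     pos := by omega
     unit_label := fun h => absurd h (by omega) }, rfl⟩

section Relations

variable (K : Type w) [Field K] {M : Type u} [MulOneClass M]

/-- The element `c(p) ∘_{i+1} c(q)` of the free operad on the `M`-triangles, where `i < 2`, and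
`p = (p₀, p₁, p₂)` and `q = (q₀, q₁, q₂)` are given by the labels of their base, first edge and
second edge. -/
noncomputable def triangleComp {n : ℕ} (h : 2 + 2 = n + 1) (i : Fin 2) (p₀ p₁ p₂ q₀ q₁ q₂ : M) :
    (freeOperad K (Triangles M)).obj n :=
  (freeOperad K (Triangles M)).comp i i.isLt h
    (freeOperad.c K Nat.two_pos (triangle p₀ p₁ p₂))
    (freeOperad.c K Nat.two_pos (triangle q₀ q₁ q₂))

variable (M)

/-- The space of relations of `NC M`, as a graded subspace of the free operad on the
`M`-triangles. It is concentrated in arity `n = 3`. -/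
noncomputable def relations (n : ℕ) : Submodule K ((freeOperad K (Triangles M)).obj n) :=
  Submodule.span K
    ({x | ∃ (h : 2 + 2 = n + 1) (p₀ p₁ p₂ q₀ q₁ q₂ r₀ r₁ : M),
        p₁ * q₀ = r₁ * r₀ ∧ r₁ * r₀ ≠ 1 ∧
        x = triangleComp K h 0 p₀ p₁ p₂ q₀ q₁ q₂ - triangleComp K h 0 p₀ r₁ p₂ r₀ q₁ q₂} ∪
     {x | ∃ (h : 2 + 2 = n + 1) (p₀ p₁ p₂ q₀ q₁ q₂ r₀ r₂ : M),
        p₁ * q₀ = r₂ * r₀ ∧ r₂ * r₀ = 1 ∧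
        x = triangleComp K h 0 p₀ p₁ p₂ q₀ q₁ q₂ - triangleComp K h 1 p₀ q₁ r₂ r₀ q₂ p₂} ∪
     {x | ∃ (h : 2 + 2 = n + 1) (p₀ p₁ p₂ q₀ q₁ q₂ r₀ r₂ : M),
        p₂ * q₀ = r₂ * r₀ ∧ r₂ * r₀ ≠ 1 ∧
        x = triangleComp K h 1 p₀ p₁ p₂ q₀ q₁ q₂ - triangleComp K h 1 p₀ p₁ r₂ r₀ q₁ q₂})

end Relations

open SyntaxTree

/-! ### Trees of triangles and their evaluation as cliques -/

section TriangleTrees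

variable {M : Type u} [MulOneClass M]

/-! A syntax tree on triangles is a triangulated polygon whose triangles carry their own labels.
Gluing the triangles gives a clique: each diagonal of the triangulation receives the product of the
two labels that meet on it, and every other diagonal receives the unit. This evaluation is a
morphism of set-operads (`cliqueOfTree_graft`), and every noncrossing clique is a value of it
(`exists_tree_of_noncrossing`). Its linear extension is therefore a surjective morphism from the
free operad to `NC K M`, and everything reduces to showing that its kernel is the ideal generated by
the relations.

The two sides of a relation evaluate to the same square, so the ideal lies in the kernel
(`relations_le_ker`). Conversely, the kernel of the linear extension of a map of sets is spanned by
the differences of basis elements with the same image (`Finsupp.ker_lmapDomain_le`), so it suffices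
that two trees with the same clique are congruent modulo the relations.

This is done with normal forms. In a normal tree the products on diagonals are carried entirely by
the outer triangle, and no diagonal cutting off a nontrivial left subtree is labeled by the unit.
Every tree is congruent to a normal one (`TreeCong.exists_isNormal`): labels are moved outwards
across diagonals, and unit diagonals on the left are flipped. A normal tree is determined by its
clique (`IsNormal.eq_of_lab_eq`), because the apex `k` of the triangle on the base can be read off:
it is the greatest `k` below the arity such that the arc `(0, k)` is not labeled by the unit, or `1`
if there is none. Two trees with the same clique thus have the same normal form
(`treeCong_of_lab_eq`). -/

theorem Triangles.eq_triangle (g : Triangles M 2) :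
    g = triangle (g.1.lab 0 2) (g.1.lab 0 1) (g.1.lab 1 2) := by
  apply Subtype.ext
  apply Clique.lab_ext
  intro x y hxy hy
  obtain ⟨rfl, rfl⟩ | ⟨rfl, rfl⟩ | ⟨rfl, rfl⟩ :
    (x = 0 ∧ y = 1) ∨ (x = 0 ∧ y = 2) ∨ (x = 1 ∧ y = 2) := by omega
  all_goals simp [triangle, Clique.lab]

theorem lab_triangle (a b c : M) {x y : ℕ} (hxy : x < y) (hy : y ≤ 2) :
    (triangle a b c).1.lab x y = if x = 0 ∧ y = 2 then a else if x = 0 then b else c := by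
  rw [Clique.lab, dif_pos ⟨hxy, hy⟩]
  rfl

/-- The syntax tree whose root is the triangle `[a | b, c]`, with left subtree `l` and right
subtree `r`. -/
def bin (a b c : M) (l r : SyntaxTree (Triangles M)) : SyntaxTree (Triangles M) :=
  node 2 Nat.two_pos (triangle a b c) ![l, r]

theorem arity_bin (a b c : M) (l r : SyntaxTree (Triangles M)) :
    (bin a b c l r).arity = l.arity + r.arity := by
  simp [bin, arity]

theorem degree_bin (a b c : M) (l r : SyntaxTree (Triangles M)) :
    (bin a b c l r).degree = 1 + (l.degree + r.degree) := by
  simp [bin, degree]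

theorem corolla_triangle (a b c : M) :
    corolla Nat.two_pos (triangle a b c) = bin a b c leaf leaf := by
  rw [corolla, bin]
  congr 1
  funext i
  fin_cases i <;> rfl

/-- Induction on syntax trees on triangles. -/
theorem bin_induction {P : SyntaxTree (Triangles M) → Prop} (hleaf : P leaf)
    (hbin : ∀ a b c l r, P l → P r → P (bin a b c l r)) (t : SyntaxTree (Triangles M)) : P t := by
  induction t with
  | leaf => exact hleaf
  | node k hk g c ih =>
    obtain rfl : k = 2 := g.2
    have hc : c = ![c 0, c 1] := by
      funext i
      fin_cases i <;> rfl
    rw [hc, g.eq_triangle]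
    exact hbin _ _ _ _ _ (ih 0) (ih 1)

theorem graft_leaf (i : ℕ) (t : SyntaxTree (Triangles M)) :
    (leaf : SyntaxTree (Triangles M)).graft i t = if i = 0 then t else leaf := by
  simp [graft, subst, eq_comm]

theorem subst_bin (a b c : M) (l r : SyntaxTree (Triangles M))
    (f : ℕ → SyntaxTree (Triangles M)) :
    (bin a b c l r).subst f = bin a b c (l.subst f) (r.subst fun j => f (l.arity + j)) := by
  rw [bin, subst, bin]
  congr 1
  funext i
  fin_cases i
  · simp [offset_zero]
  · have h := offset_succ (fun b : Fin 2 => (![l, r] b).arity) 0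
    rw [show ((0 : Fin 2) : ℕ) = 0 from rfl, offset_zero] at h
    simp only [zero_add] at h
    simp [h]

theorem graft_bin_left (a b c : M) (l r t : SyntaxTree (Triangles M)) {i : ℕ} (hi : i < l.arity) :
    (bin a b c l r).graft i t = bin a b c (l.graft i t) r := by
  rw [graft, subst_bin, graft]
  congr 1
  conv_rhs => rw [← subst_leaf r]
  exact subst_congr _ fun j _ => if_neg (by omega)

theorem graft_bin_right (a b c : M) (l r t : SyntaxTree (Triangles M)) {i : ℕ}
    (hi : l.arity ≤ i) :
    (bin a b c l r).graft i t = bin a b c l (r.graft (i - l.arity) t) := by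
  rw [graft, subst_bin, graft]
  congr 1
  · conv_rhs => rw [← subst_leaf l]
    exact subst_congr _ fun j _ => if_neg (by omega)
  · congr 1
    funext j
    simp only [show l.arity + j = i ↔ j = i - l.arity by omega]

theorem arity_node_triangles {k : ℕ} (hk : 0 < k) (g : Triangles M k)
    (c : Fin k → SyntaxTree (Triangles M)) :
    (node k hk g c).arity =
      (c ⟨0, hk⟩).arity + (c ⟨1, by have := g.2; omega⟩).arity := by
  obtain rfl : k = 2 := g.2
  simp [arity]

/-- The clique obtained by evaluating a syntax tree on triangles. -/
def cliqueOfTree : (t : SyntaxTree (Triangles M)) → Clique M t.arity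
  | leaf => Clique.unit
  | node k hk g c =>
    -- The right subtree is glued first, so that the first edge of the triangle still has index `0`
    -- when the left subtree is glued.
    Clique.comp 0 (n := 1 + (c ⟨1, by have := g.2; omega⟩).arity)
      (by rw [arity_node_triangles]; omega)
      (Clique.comp 1 (by have := g.2; omega) g.1 (cliqueOfTree (c ⟨1, by have := g.2; omega⟩)))
      (cliqueOfTree (c ⟨0, hk⟩))

theorem cliqueOfTree_bin (a b c : M) (l r : SyntaxTree (Triangles M)) :
    cliqueOfTree (bin a b c l r) =
      Clique.comp 0 (n := 1 + r.arity) (by rw [arity_bin]; omega)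
        (Clique.comp 1 (by omega) (triangle a b c).1 (cliqueOfTree r)) (cliqueOfTree l) := rfl

/-- The outer triangle has vertices `0`, `l.arity` and `l.arity + r.arity`. Products occur only on
its two lower edges, and the last case concerns the arcs passing over its apex. All later
computations of labels rest on this formula. -/
theorem lab_cliqueOfTree_bin (a b c : M) (l r : SyntaxTree (Triangles M)) {x y : ℕ} (hxy : x < y)
    (hy : y ≤ l.arity + r.arity) :
    (cliqueOfTree (bin a b c l r)).lab x y =
      if x = 0 ∧ y = l.arity + r.arity then a
      else if x = 0 ∧ y = l.arity then b * (cliqueOfTree l).lab 0 l.arity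
      else if x = l.arity ∧ y = l.arity + r.arity then c * (cliqueOfTree r).lab 0 r.arity
      else if y ≤ l.arity then (cliqueOfTree l).lab x y
      else if l.arity ≤ x then (cliqueOfTree r).lab (x - l.arity) (y - l.arity)
      else 1 := by
  have hl := l.arity_pos
  have hr := r.arity_pos
  rw [cliqueOfTree_bin, Clique.lab_comp _ _ _ _ hxy (by rw [arity_bin]; exact hy)]
  split_ifs
  all_goals try (exfalso; omega)
  all_goals try rw [Clique.lab_comp]
  all_goals try split_ifs
  all_goals try (exfalso; omega)
  all_goals try rw [lab_triangle]
  all_goals try split_ifs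
  all_goals first
    | omega
    | rfl
    | (exfalso; omega)
    | exact Clique.lab_congr _ (by omega) (by omega)
    | (exfalso; tauto)

theorem lab_cliqueOfTree_corolla (a b c : M) {x y : ℕ} (hxy : x < y) (hy : y ≤ 2) :
    (cliqueOfTree (bin a b c leaf leaf)).lab x y = (triangle a b c).1.lab x y := by
  rw [lab_cliqueOfTree_bin _ _ _ _ _ hxy (by simpa [arity] using hy), lab_triangle _ _ _ hxy hy]
  obtain ⟨rfl, rfl⟩ | ⟨rfl, rfl⟩ | ⟨rfl, rfl⟩ :
    (x = 0 ∧ y = 1) ∨ (x = 0 ∧ y = 2) ∨ (x = 1 ∧ y = 2) := by omega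
  all_goals simp [arity, cliqueOfTree, Clique.lab_unit]

theorem noncrossing_cliqueOfTree (t : SyntaxTree (Triangles M)) :
    (cliqueOfTree t).Noncrossing := by
  induction t using bin_induction with
  | hleaf => exact fun a b h₁ h₂ h₃ => Or.inl rfl
  | hbin a b c l r hl hr =>
    have := r.arity_pos
    rw [cliqueOfTree_bin]
    exact .comp (by omega) _ (.comp (by omega) _ (Clique.noncrossing_of_arity_two _) hr) hl

/-- Grafting in the left subtree is sequential associativity; grafting in the right subtree is
sequential associativity followed by the parallel axiom. The result is a variable `u` because the
type of its clique depends on its arity: rewriting `hu` and substituting avoids any transport. -/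
theorem cliqueOfTree_graft (s t : SyntaxTree (Triangles M)) {i : ℕ} (hi : i < s.arity)
    (u : SyntaxTree (Triangles M)) (hu : s.graft i t = u) (h : s.arity + t.arity = u.arity + 1) :
    cliqueOfTree u = Clique.comp i h (cliqueOfTree s) (cliqueOfTree t) := by
  induction s using bin_induction generalizing i u with
  | hleaf =>
    obtain rfl : i = 0 := by simp [arity] at hi; omega
    rw [graft_leaf, if_pos rfl] at hu
    subst hu
    exact (Clique.unit_comp h _ _).symm
  | hbin a b c l r hl hr =>
    have hlp := l.arity_pos
    have hrp := r.arity_pos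
    have htp := t.arity_pos
    rw [arity_bin] at hi
    by_cases hil : i < l.arity
    · rw [graft_bin_left _ _ _ _ _ _ hil] at hu
      subst hu
      have har := arity_graft hil t
      have hb := arity_bin a b c l r
      have hb' := arity_bin a b c (l.graft i t) r
      rw [cliqueOfTree_bin, cliqueOfTree_bin, hl hil _ rfl (by omega)]
      have := Clique.comp_assoc (i := 0) (a := (bin a b c l r).arity) (b := (l.graft i t).arity)
        (r := (bin a b c (l.graft i t) r).arity) (by omega) hil (by omega) h (by omega) (by omega)
        (Clique.comp 1 (r := 1 + r.arity) (by omega) (triangle a b c).1 (cliqueOfTree r))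
        (cliqueOfTree l) (cliqueOfTree t)
      simp only [zero_add] at this
      exact this.symm
    · obtain ⟨j, rfl⟩ := Nat.exists_eq_add_of_le (not_lt.1 hil)
      have hj : j < r.arity := by omega
      rw [graft_bin_right _ _ _ _ _ _ (by omega), Nat.add_sub_cancel_left] at hu
      subst hu
      have har := arity_graft hj t
      rw [cliqueOfTree_bin, cliqueOfTree_bin, hr hj _ rfl (by omega),
        ← Clique.comp_assoc (a := 1 + r.arity) (by omega) hj (by omega) (by omega) (by omega)
          (by omega),
        ← Clique.comp_parallel (a := (bin a b c l r).arity) (by omega) (by omega)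
          (by rw [arity_bin]; omega) (by rw [arity_bin, arity_bin]; omega)]
      -- The parallel axiom produces the index `1 + j + l.arity - 1`, to be identified with `l.arity
      -- + j`.
      congr 1
      omega

end TriangleTrees

/-! ### Normal trees: uniqueness, and a tree for each noncrossing clique -/

section NormalForms

variable {M : Type u} [MulOneClass M]

/-- Normal trees with root label `a`: inner bases are labeled by the unit, and so is no
first edge on which a tree is grafted. By convention the root label of the leaf is the unit. -/
inductive IsNormal : M → SyntaxTree (Triangles M) → Prop
  | leaf : IsNormal 1 leaf
  | bin (a b c : M) {l r : SyntaxTree (Triangles M)} (hb : l = SyntaxTree.leaf ∨ b ≠ 1)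
      (hl : IsNormal 1 l) (hr : IsNormal 1 r) : IsNormal a (bin a b c l r)

theorem IsNormal.lab_base {a : M} {t : SyntaxTree (Triangles M)} (h : IsNormal a t) :
    (cliqueOfTree t).lab 0 t.arity = a := by
  cases h with
  | leaf => exact Clique.lab_of_one _ rfl _ _
  | bin a b c hb hl hr =>
    rename_i l r
    have := l.arity_pos
    have har := arity_bin a b c l r
    rw [lab_cliqueOfTree_bin _ _ _ _ _ (by omega) har.le, if_pos ⟨rfl, har⟩]

theorem eq_leaf_of_arity_eq_one {t : SyntaxTree (Triangles M)} (h : t.arity = 1) : t = leaf := by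
  induction t using bin_induction with
  | hleaf => rfl
  | hbin a b c l r _ _ =>
    have := l.arity_pos
    have := r.arity_pos
    rw [arity_bin] at h
    omega

/-- If `l'` is not a leaf, the arc `(0, l'.arity)` carries `b' * 1 ≠ 1` in the second clique. Were
the apex of the first tree strictly before `l'.arity`, this arc would pass over it and carry `1`.
Used in both directions, this shows that two normal trees with the same clique have the same apex.
-/
theorem IsNormal.arity_left_le {b c b' c' : M} {l r l' r' : SyntaxTree (Triangles M)} {a a' : M}
    (hb' : l' = SyntaxTree.leaf ∨ b' ≠ 1) (hl' : IsNormal 1 l')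
    (har : l.arity + r.arity = l'.arity + r'.arity)
    (h : ∀ x y, x < y → y ≤ l.arity + r.arity → ¬(x = 0 ∧ y = l.arity + r.arity) →
      (cliqueOfTree (_root_.bin a b c l r)).lab x y =
        (cliqueOfTree (_root_.bin a' b' c' l' r')).lab x y) :
    l'.arity ≤ l.arity := by
  by_contra hlt
  have := l.arity_pos
  have := r'.arity_pos
  rcases hb' with rfl | hb'
  · have : (SyntaxTree.leaf : SyntaxTree (Triangles M)).arity = 1 := rfl
    omega
  · have := h 0 l'.arity (by omega) (by omega) (by omega)
    rw [lab_cliqueOfTree_bin _ _ _ _ _ (by omega) (by omega),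
      lab_cliqueOfTree_bin _ _ _ _ _ (by omega) (by omega), if_neg (by omega), if_neg (by omega),
      if_neg (by omega), if_neg (by omega), if_neg (by omega), if_neg (by omega),
      if_pos ⟨rfl, rfl⟩, hl'.lab_base, mul_one] at this
    exact hb' this.symm

/-- A normal tree is determined by its root label and the labels of the other arcs of its
clique. -/
theorem IsNormal.eq_of_lab_eq {a : M} {s t : SyntaxTree (Triangles M)} (hs : IsNormal a s)
    (ht : IsNormal a t) (har : s.arity = t.arity)
    (h : ∀ x y, x < y → y ≤ s.arity → ¬(x = 0 ∧ y = s.arity) →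
      (cliqueOfTree s).lab x y = (cliqueOfTree t).lab x y) : s = t := by
  induction hs generalizing t with
  | leaf => exact (eq_leaf_of_arity_eq_one har.symm).symm
  | bin a b c hb hl hr ihl ihr =>
    rename_i l r
    have hlp := l.arity_pos
    have hrp := r.arity_pos
    cases ht with
    | leaf =>
      rw [arity_bin, arity] at har
      omega
    | bin _ b' c' hb' hl' hr' =>
      rename_i l' r'
      have hlp' := l'.arity_pos
      have hrp' := r'.arity_pos
      simp only [arity_bin] at h har
      have hll : l.arity = l'.arity := le_antisymm
        (arity_left_le hb hl har.symm fun x y h₁ h₂ h₃ =>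
          (h x y h₁ (har ▸ h₂) (har ▸ h₃)).symm)
        (arity_left_le hb' hl' har h)
      have hrr : r.arity = r'.arity := by omega
      have hb : b = b' := by
        have := h 0 l.arity (by omega) (by omega) (by omega)
        rwa [lab_cliqueOfTree_bin _ _ _ _ _ (by omega) (by omega),
          lab_cliqueOfTree_bin _ _ _ _ _ (by omega) (by omega), if_neg (by omega),
          if_pos (by omega), if_neg (by omega), if_pos (by omega), hl.lab_base, hl'.lab_base,
          mul_one, mul_one] at this
      have hc : c = c' := by
        have := h l.arity (l.arity + r.arity) (by omega) (by omega) (by omega)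
        rwa [lab_cliqueOfTree_bin _ _ _ _ _ (by omega) (by omega),
          lab_cliqueOfTree_bin _ _ _ _ _ (by omega) (by omega), if_neg (by omega),
          if_neg (by omega), if_pos (by omega), if_neg (by omega), if_neg (by omega),
          if_pos (by omega), hr.lab_base, hr'.lab_base, mul_one, mul_one] at this
      have hl : l = l' := by
        -- The base of a subtree has to be excluded from the comparison, since in the whole clique
        -- that arc carries a product; its label is known to be `1` by normality.
        refine ihl hl' hll fun x y h₁ h₂ h₃ => ?_
        have := h x y h₁ (by omega) (by omega)
        rwa [lab_cliqueOfTree_bin _ _ _ _ _ (by omega) (by omega),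
          lab_cliqueOfTree_bin _ _ _ _ _ (by omega) (by omega), if_neg (by omega),
          if_neg (by omega), if_neg (by omega), if_pos (by omega), if_neg (by omega),
          if_neg (by omega), if_neg (by omega), if_pos (by omega)] at this
      have hr : r = r' := by
        refine ihr hr' hrr fun x y h₁ h₂ h₃ => ?_
        have := h (x + l.arity) (y + l.arity) (by omega) (by omega) (by omega)
        rwa [lab_cliqueOfTree_bin _ _ _ _ _ (by omega) (by omega),
          lab_cliqueOfTree_bin _ _ _ _ _ (by omega) (by omega), if_neg (by omega),
          if_neg (by omega), if_neg (by omega), if_neg (by omega), if_pos (by omega),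
          if_neg (by omega), if_neg (by omega), if_neg (by omega), if_neg (by omega),
          if_pos (by omega), ← hll, Nat.add_sub_cancel, Nat.add_sub_cancel] at this
      rw [hb, hc, hl, hr]

/-- Locates the apex when `f y` is the label of the arc from the first vertex to the vertex `y`. The
default `k = 1` makes the left subtree a leaf, whatever the value of `f 1`. -/
theorem exists_greatest_ne_one (f : ℕ → M) {n : ℕ} (hn : 2 ≤ n) :
    ∃ k, 1 ≤ k ∧ k < n ∧ (k = 1 ∨ f k ≠ 1) ∧ ∀ y, k < y → y < n → f y = 1 := by
  induction n, hn using Nat.le_induction with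
  | base => exact ⟨1, by omega, by omega, Or.inl rfl, fun y _ _ => by omega⟩
  | succ n hn ih =>
    by_cases hf : f n = 1
    · obtain ⟨k, h₁, h₂, h₃, h₄⟩ := ih
      refine ⟨k, h₁, by omega, h₃, fun y hy hy' => ?_⟩
      obtain rfl | hlt : y = n ∨ y < n := by omega
      exacts [hf, h₄ y hy hlt]
    · exact ⟨n, by omega, by omega, Or.inr hf, fun y _ _ => by omega⟩

/-- The noncrossing labels of the arcs inside `[o, o + n]`, apart from the base which may be
chosen freely, are the labels of the clique of a tree. -/
theorem exists_tree_of_noncrossing (P : ℕ → ℕ → M)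
    (hP : ∀ x y x' y', x < x' → x' < y → y < y' → P x y = 1 ∨ P x' y' = 1) (n o : ℕ) (a : M)
    (hn : 1 ≤ n) (ha : n = 1 → a = 1) :
    ∃ t : SyntaxTree (Triangles M), t.arity = n ∧ (cliqueOfTree t).lab 0 n = a ∧
      ∀ x y, x < y → y ≤ n → ¬(x = 0 ∧ y = n) →
        (cliqueOfTree t).lab x y = P (o + x) (o + y) := by
  induction n using Nat.strong_induction_on generalizing o a with
  | _ n ih =>
  obtain rfl | hn : n = 1 ∨ 2 ≤ n := by omega
  · exact ⟨leaf, rfl, (Clique.lab_of_one _ rfl _ _).trans (ha rfl).symm,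
      fun x y _ _ _ => by omega⟩
  obtain ⟨k, h₁, h₂, h₃, h₄⟩ := exists_greatest_ne_one (fun y => P o (o + y)) hn
  -- Both subtrees receive the base label `1`, so the outer triangle alone carries the labels of its
  -- edges.
  obtain ⟨l, hl, hl₀, hl₁⟩ := ih k h₂ o 1 h₁ fun _ => rfl
  obtain ⟨r, hr, hr₀, hr₁⟩ := ih (n - k) (by omega) (o + k) 1 (by omega) fun _ => rfl
  subst hl
  rw [← hr] at hr₀ hr₁
  refine ⟨bin a (P o (o + l.arity)) (P (o + l.arity) (o + n)) l r, by rw [arity_bin]; omega, ?_, ?_⟩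
  · rw [lab_cliqueOfTree_bin _ _ _ _ _ (by omega) (by omega), if_pos (by omega)]
  · intro x y hxy hy hb
    rw [lab_cliqueOfTree_bin _ _ _ _ _ (by omega) (by omega), if_neg (by omega), hl₀, hr₀]
    split_ifs with c₁ c₂ c₃ c₄
    · rw [mul_one, c₁.1, c₁.2, add_zero]
    · rw [mul_one, c₂.1, c₂.2]
      congr 1
      omega
    · exact hl₁ x y hxy c₃ c₁
    · rw [hr₁ _ _ (by omega) (by omega) (by omega)]
      congr 1 <;> omega
    -- An arc passing over the apex has label `1`: by maximality of the apex if it starts at `0`,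
    -- and otherwise because it crosses the arc from `0` to the apex, which is solid since `0 < x <
    -- l.arity` excludes the default case.
    · symm
      obtain rfl | hx : x = 0 ∨ 0 < x := by omega
      · exact h₄ y (by omega) (by omega)
      · have hk : P o (o + l.arity) ≠ 1 := h₃.resolve_left (by omega)
        exact (hP o (o + l.arity) (o + x) (o + y) (by omega) (by omega) (by omega)).resolve_left hk

end NormalForms

/-! ### Congruence modulo the relations, and reduction to normal form -/

section Congruence

variable (K : Type w) [Field K]

theorem ofTree_comp {G : ℕ → Type u} {n m r i : ℕ} (hi : i < n) (h : n + m = r + 1)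
    {s t : SyntaxTree G} (hs : s.arity = n) (ht : t.arity = m) (hst : (s.graft i t).arity = r) :
    (freeOperad K G).comp i hi h (freeOperad.ofTree K s hs) (freeOperad.ofTree K t ht) =
      freeOperad.ofTree K (s.graft i t) hst := by
  refine (NSSetOperad.linComp_single K (setOperad G) i hi h _ _ 1 1).trans ?_
  rw [mul_one]
  rfl

variable {M : Type u} [MulOneClass M]

/-- Two trees are congruent if they have the same class modulo the relations of `NC M`. -/
def TreeCong (s t : SyntaxTree (Triangles M)) : Prop :=
  ∃ (n : ℕ) (hs : s.arity = n) (ht : t.arity = n),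
    freeOperad.ofTree K s hs - freeOperad.ofTree K t ht ∈
      (NSOperad.Ideal.span (relations K M)).carrier n

namespace TreeCong

variable {K}

theorem refl (s : SyntaxTree (Triangles M)) : TreeCong K s s :=
  ⟨_, rfl, rfl, by rw [sub_self]; exact zero_mem _⟩

theorem symm {s t : SyntaxTree (Triangles M)} (h : TreeCong K s t) : TreeCong K t s := by
  obtain ⟨n, hs, ht, h⟩ := h
  exact ⟨n, ht, hs, by rw [← neg_sub]; exact neg_mem h⟩

theorem trans {s t u : SyntaxTree (Triangles M)} (h : TreeCong K s t) (h' : TreeCong K t u) :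
    TreeCong K s u := by
  obtain ⟨n, hs, ht, h⟩ := h
  obtain ⟨_, rfl, hu, h'⟩ := h'
  subst ht
  exact ⟨_, hs, hu, by rw [← sub_add_sub_cancel]; exact add_mem h h'⟩

theorem graft_left {s s' : SyntaxTree (Triangles M)} (h : TreeCong K s s')
    (t : SyntaxTree (Triangles M)) {i : ℕ} (hi : i < s.arity) :
    TreeCong K (s.graft i t) (s'.graft i t) := by
  obtain ⟨_, rfl, hs, h⟩ := h
  have h₁ := arity_graft hi t
  have h₂ := arity_graft (hs.symm ▸ hi) t
  have ht := t.arity_pos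
  refine ⟨(s.graft i t).arity, rfl, by rw [h₁, h₂, hs], ?_⟩
  have hr : s.arity + t.arity = (s.graft i t).arity + 1 := by omega
  rw [← ofTree_comp K hi hr rfl rfl, ← ofTree_comp K hi hr hs rfl, ← LinearMap.sub_apply,
    ← map_sub]
  exact NSOperad.Ideal.comp_mem_left _ _ _ _ _ _ h

theorem graft_right (s : SyntaxTree (Triangles M)) {t t' : SyntaxTree (Triangles M)}
    (h : TreeCong K t t') {i : ℕ} (hi : i < s.arity) :
    TreeCong K (s.graft i t) (s.graft i t') := by
  obtain ⟨_, rfl, ht, h⟩ := h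
  have h₁ := arity_graft hi t
  have h₂ := arity_graft hi t'
  have := t.arity_pos
  refine ⟨(s.graft i t).arity, rfl, by rw [h₁, h₂, ht], ?_⟩
  have hr : s.arity + t.arity = (s.graft i t).arity + 1 := by omega
  rw [← ofTree_comp K hi hr rfl rfl, ← ofTree_comp K hi hr rfl ht, ← map_sub]
  exact NSOperad.Ideal.comp_mem_right _ _ _ _ _ _ h

theorem bin_left (a b c : M) {l l' : SyntaxTree (Triangles M)} (h : TreeCong K l l')
    (r : SyntaxTree (Triangles M)) : TreeCong K (bin a b c l r) (bin a b c l' r) := by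
  have := graft_right (bin a b c leaf r) h (i := 0) (by rw [arity_bin, arity]; omega)
  rwa [graft_bin_left _ _ _ _ _ _ (by simp [arity]), graft_bin_left _ _ _ _ _ _ (by simp [arity]),
    graft_leaf, graft_leaf, if_pos rfl, if_pos rfl] at this

theorem bin_right (a b c : M) (l : SyntaxTree (Triangles M)) {r r' : SyntaxTree (Triangles M)}
    (h : TreeCong K r r') : TreeCong K (bin a b c l r) (bin a b c l r') := by
  have := graft_right (bin a b c l leaf) h (i := l.arity) (by rw [arity_bin, arity]; omega)
  rwa [graft_bin_right _ _ _ _ _ _ le_rfl, graft_bin_right _ _ _ _ _ _ le_rfl, Nat.sub_self,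
    graft_leaf, graft_leaf, if_pos rfl, if_pos rfl] at this

/-- Two congruent trees of arity `3` stay congruent after grafting trees on their leaves. -/
theorem graft_three {s s' : SyntaxTree (Triangles M)} (h : TreeCong K s s') (hs : s.arity = 3)
    (x y z : SyntaxTree (Triangles M)) :
    TreeCong K (((s.graft 2 z).graft 1 y).graft 0 x) (((s'.graft 2 z).graft 1 y).graft 0 x) := by
  have hy := y.arity_pos
  have hz := z.arity_pos
  have h₁ := arity_graft (s := s) (i := 2) (by omega) z
  have h₂ := arity_graft (s := s.graft 2 z) (i := 1) (by omega) y
  exact ((h.graft_left z (by omega)).graft_left y (by omega)).graft_left x (by omega)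

end TreeCong

theorem triangleComp_zero {n : ℕ} (h : 2 + 2 = n + 1) (p₀ p₁ p₂ q₀ q₁ q₂ : M) :
    triangleComp K h 0 p₀ p₁ p₂ q₀ q₁ q₂ =
      freeOperad.ofTree K (bin p₀ p₁ p₂ (bin q₀ q₁ q₂ leaf leaf) leaf)
        (by simp only [arity_bin, arity]; omega) := by
  have hg : (corolla Nat.two_pos (triangle p₀ p₁ p₂)).graft 0
      (corolla Nat.two_pos (triangle q₀ q₁ q₂)) =
      bin p₀ p₁ p₂ (bin q₀ q₁ q₂ leaf leaf) leaf := by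
    rw [corolla_triangle, corolla_triangle, graft_bin_left _ _ _ _ _ _ (by simp [arity]),
      graft_leaf, if_pos rfl]
  simp only [← hg]
  exact ofTree_comp K _ h _ _ _

theorem triangleComp_one {n : ℕ} (h : 2 + 2 = n + 1) (p₀ p₁ p₂ q₀ q₁ q₂ : M) :
    triangleComp K h 1 p₀ p₁ p₂ q₀ q₁ q₂ =
      freeOperad.ofTree K (bin p₀ p₁ p₂ leaf (bin q₀ q₁ q₂ leaf leaf))
        (by simp only [arity_bin, arity]; omega) := by
  have hg : (corolla Nat.two_pos (triangle p₀ p₁ p₂)).graft 1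
      (corolla Nat.two_pos (triangle q₀ q₁ q₂)) =
      bin p₀ p₁ p₂ leaf (bin q₀ q₁ q₂ leaf leaf) := by
    rw [corolla_triangle, corolla_triangle, graft_bin_right _ _ _ _ _ _ (by simp [arity]),
      arity, Nat.sub_self, graft_leaf, if_pos rfl]
  simp only [← hg]
  exact ofTree_comp K _ h _ _ _

namespace TreeCong

variable {K}

theorem of_mem_relations {s t : SyntaxTree (Triangles M)} {n : ℕ} (hs : s.arity = n)
    (ht : t.arity = n)
    (h : freeOperad.ofTree K s hs - freeOperad.ofTree K t ht ∈ relations K M n) :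
    TreeCong K s t := by
  refine ⟨n, hs, ht, ?_⟩
  simp only [NSOperad.Ideal.span, Submodule.mem_iInf]
  exact fun I hI => hI n h

/-- Grafting from right to left keeps the positions of the leaves still to be filled, hence the
indices `2`, `1`, `0`. -/
theorem graft_three_left (p₀ p₁ p₂ q₀ q₁ q₂ : M) (x y z : SyntaxTree (Triangles M)) :
    ((((bin p₀ p₁ p₂ (bin q₀ q₁ q₂ leaf leaf) leaf).graft 2 z).graft 1 y).graft 0 x) =
      bin p₀ p₁ p₂ (bin q₀ q₁ q₂ x y) z := by
  rw [graft_bin_right (i := 2) _ _ _ _ _ _ (by simp [arity_bin, arity]),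
    graft_bin_left (i := 1) _ _ _ _ _ _ (by simp [arity_bin, arity]),
    graft_bin_left (i := 0) _ _ _ _ _ _ (arity_pos _),
    graft_bin_right (i := 1) _ _ _ _ _ _ (by simp [arity]),
    graft_bin_left (i := 0) _ _ _ _ _ _ (by simp [arity])]
  simp [graft_leaf, arity_bin, arity]

theorem graft_three_right (p₀ p₁ p₂ q₀ q₁ q₂ : M) (x y z : SyntaxTree (Triangles M)) :
    ((((bin p₀ p₁ p₂ leaf (bin q₀ q₁ q₂ leaf leaf)).graft 2 z).graft 1 y).graft 0 x) =
      bin p₀ p₁ p₂ x (bin q₀ q₁ q₂ y z) := by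
  rw [graft_bin_right (i := 2) _ _ _ _ _ _ (by simp [arity]),
    graft_bin_right (i := 1) _ _ _ _ _ _ (by simp [arity]),
    graft_bin_left (i := 0) _ _ _ _ _ _ (by simp [arity]),
    graft_bin_right _ _ _ _ _ _ (by simp [arity]),
    graft_bin_left _ _ _ _ _ _ (by simp [arity])]
  simp [graft_leaf, arity]

/-- Only the product of the two labels of a solid diagonal on the left matters. -/
theorem slide_left (p₀ p₁ p₂ q₀ q₁ q₂ r₀ r₁ : M) (h : p₁ * q₀ = r₁ * r₀) (h' : r₁ * r₀ ≠ 1)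
    (x y z : SyntaxTree (Triangles M)) :
    TreeCong K (bin p₀ p₁ p₂ (bin q₀ q₁ q₂ x y) z) (bin p₀ r₁ p₂ (bin r₀ q₁ q₂ x y) z) := by
  simp only [← graft_three_left _ _ _ _ _ _ x y z]
  refine graft_three (of_mem_relations (n := 3) rfl rfl (Submodule.subset_span ?_)) rfl x y z
  refine Or.inl (Or.inl ⟨rfl, p₀, p₁, p₂, q₀, q₁, q₂, r₀, r₁, h, h', ?_⟩)
  rw [triangleComp_zero, triangleComp_zero]

/-- A diagonal labeled by the unit may be flipped. -/
theorem flip (p₀ p₁ p₂ q₀ q₁ q₂ r₀ r₂ : M) (h : p₁ * q₀ = 1) (h' : r₂ * r₀ = 1)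
    (x y z : SyntaxTree (Triangles M)) :
    TreeCong K (bin p₀ p₁ p₂ (bin q₀ q₁ q₂ x y) z) (bin p₀ q₁ r₂ x (bin r₀ q₂ p₂ y z)) := by
  rw [← graft_three_left, ← graft_three_right]
  refine graft_three (of_mem_relations (n := 3) rfl rfl (Submodule.subset_span ?_)) rfl x y z
  refine Or.inl (Or.inr ⟨rfl, p₀, p₁, p₂, q₀, q₁, q₂, r₀, r₂, h.trans h'.symm, h', ?_⟩)
  rw [triangleComp_zero, triangleComp_one]

/-- Only the product of the two labels of a diagonal on the right matters. -/
theorem slide_right (p₀ p₁ p₂ q₀ q₁ q₂ r₀ r₂ : M) (h : p₂ * q₀ = r₂ * r₀)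
    (x y z : SyntaxTree (Triangles M)) :
    TreeCong K (bin p₀ p₁ p₂ x (bin q₀ q₁ q₂ y z)) (bin p₀ p₁ r₂ x (bin r₀ q₁ q₂ y z)) := by
  -- The third kind of relation excludes the product `1`. In that case both trees are flips of one
  -- tree, whose left diagonal is labeled by `1 * 1`.
  by_cases h' : r₂ * r₀ = 1
  · exact (flip p₀ 1 q₂ 1 p₁ q₁ q₀ p₂ (one_mul 1) (h.trans h') x y z).symm.trans
      (flip p₀ 1 q₂ 1 p₁ q₁ r₀ r₂ (one_mul 1) h' x y z)
  · simp only [← graft_three_right _ _ _ _ _ _ x y z]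
    refine graft_three (of_mem_relations (n := 3) rfl rfl (Submodule.subset_span ?_)) rfl x y z
    refine Or.inr ⟨rfl, p₀, p₁, p₂, q₀, q₁, q₂, r₀, r₂, h, h', ?_⟩
    rw [triangleComp_one, triangleComp_one]

/-- The root label `d` of the right subtree is absorbed by the second edge of the outer triangle;
for a leaf, `d = 1` by convention. -/
theorem exists_bin_right_isNormal (a b c d : M) (l : SyntaxTree (Triangles M))
    {r : SyntaxTree (Triangles M)} (hr : IsNormal d r) :
    ∃ r', IsNormal 1 r' ∧ TreeCong K (bin a b c l r) (bin a b (c * d) l r') := by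
  cases hr with
  | leaf => exact ⟨_, .leaf, by rw [mul_one]; exact refl _⟩
  | bin _ b' c' hb hl hr =>
    exact ⟨_, .bin 1 b' c' hb hl hr, slide_right _ _ _ _ _ _ _ _ (mul_one _).symm _ _ _⟩

/-- The induction is on the left subtree, with the outer labels and the right subtree arbitrary.
This is what makes the flips terminate: a flip moves part of the left subtree to the right, and
leaves only proper subtrees on the left. -/
theorem exists_bin_isNormal (a b c : M) {d e : M} {l r : SyntaxTree (Triangles M)}
    (hl : IsNormal d l) (hr : IsNormal e r) :
    ∃ t, IsNormal a t ∧ TreeCong K (bin a b c l r) t := by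
  induction hl generalizing a b c e r with
  | leaf =>
    obtain ⟨r', hr', h⟩ := exists_bin_right_isNormal (K := K) a b c e leaf hr
    exact ⟨_, .bin a b _ (Or.inl rfl) .leaf hr', h⟩
  | bin q₀ q₁ q₂ hb hx hy ihx ihy =>
    by_cases h : b * q₀ = 1
    · obtain ⟨u, hu, h₁⟩ := ihy 1 q₂ c hr
      obtain ⟨t, ht, h₂⟩ := ihx a q₁ 1 hu
      exact ⟨t, ht, (flip _ _ _ _ _ _ 1 1 h (mul_one 1) _ _ _).trans
        ((bin_right _ _ _ _ h₁).trans h₂)⟩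
    · obtain ⟨r', hr', h₁⟩ := exists_bin_right_isNormal (K := K) a b c e (bin q₀ q₁ q₂ _ _) hr
      exact ⟨_, .bin a (b * q₀) _ (Or.inr h) (.bin 1 q₁ q₂ hb hx hy) hr',
        h₁.trans (slide_left _ _ _ _ _ _ _ _ (mul_one _).symm (by rwa [mul_one]) _ _ _)⟩

theorem exists_isNormal (t : SyntaxTree (Triangles M)) :
    ∃ a u, IsNormal a u ∧ TreeCong K t u := by
  induction t using bin_induction with
  | hleaf => exact ⟨1, _, .leaf, refl _⟩
  | hbin a b c l r hl hr =>
    obtain ⟨d, l', hl', h₁⟩ := hl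
    obtain ⟨e, r', hr', h₂⟩ := hr
    obtain ⟨t, ht, h₃⟩ := exists_bin_isNormal (K := K) a b c hl' hr'
    exact ⟨a, t, ht, (bin_left _ _ _ h₁ _).trans ((bin_right _ _ _ _ h₂).trans h₃)⟩

end TreeCong

end Congruence

/-! ### Linear extensions of maps of sets -/

section Linearization

variable (K : Type w) [Field K]

theorem NSSetOperad.lmapDomain_linComp {X : NSSetOperad.{u}} {Y : NSSetOperad.{v}}
    (f : ∀ n, X.obj n → Y.obj n) {n m r : ℕ} (i : ℕ) (hi : i < n) (h : n + m = r + 1)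
    (hf : ∀ x y, f r (X.comp i hi h x y) = Y.comp i hi h (f n x) (f m y))
    (x : X.obj n →₀ K) (y : X.obj m →₀ K) :
    Finsupp.lmapDomain K K (f r) (X.linComp K i hi h x y) =
      Y.linComp K i hi h (Finsupp.lmapDomain K K (f n) x) (Finsupp.lmapDomain K K (f m) y) := by
  induction x using Finsupp.induction_linear with
  | zero => simp only [map_zero, LinearMap.zero_apply]
  | add x x' hx hx' => simp only [map_add, LinearMap.add_apply, hx, hx']
  | single x a =>
  induction y using Finsupp.induction_linear with
  | zero => simp only [map_zero]
  | add y y' hy hy' => simp only [map_add, hy, hy']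
  | single y b =>
    simp only [linComp_single, Finsupp.lmapDomain_apply, Finsupp.mapDomain_single, hf]

/-- For a section `σ` of `f`, each basis element is congruent modulo `N` to its image under `σ ∘ f`.
By linearity so is every `x`, and that image vanishes when `x` is in the kernel. -/
theorem Finsupp.ker_lmapDomain_le {α : Type u} {β : Type v} {f : α → β}
    (hf : Function.Surjective f) (N : Submodule K (α →₀ K))
    (h : ∀ a b, f a = f b → Finsupp.single a 1 - Finsupp.single b 1 ∈ N) :
    LinearMap.ker (Finsupp.lmapDomain K K f) ≤ N := by
  obtain ⟨σ, hσ⟩ := hf.hasRightInverse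
  have key : ∀ x : α →₀ K, x - Finsupp.mapDomain σ (Finsupp.mapDomain f x) ∈ N := fun x => by
    induction x using Finsupp.induction_linear with
    | zero =>
      rw [Finsupp.mapDomain_zero, Finsupp.mapDomain_zero, sub_zero]
      exact zero_mem _
    | add x x' hx hx' =>
      rw [Finsupp.mapDomain_add, Finsupp.mapDomain_add, add_sub_add_comm]
      exact add_mem hx hx'
    | single t a =>
      rw [Finsupp.mapDomain_single, Finsupp.mapDomain_single]
      have := N.smul_mem a (h t (σ (f t)) (hσ (f t)).symm)
      simpa only [smul_sub, Finsupp.smul_single, smul_eq_mul, mul_one] using this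
  intro x hx
  have := key x
  rw [LinearMap.mem_ker, Finsupp.lmapDomain_apply] at hx
  rwa [hx, Finsupp.mapDomain_zero, sub_zero] at this

end Linearization

/-! ### The evaluation morphism, its kernel and the presentation -/

section Evaluation

variable {M : Type u} [MulOneClass M]

/-- The evaluation of the syntax trees of arity `n` on triangles as noncrossing cliques. -/
def evalTree (n : ℕ) (t : (setOperad (Triangles M)).obj n) : (noncrossingSetOperad M).obj n :=
  t.2 ▸ ⟨cliqueOfTree t.1, noncrossing_cliqueOfTree t.1⟩

theorem evalTree_one : evalTree 1 (setOperad (Triangles M)).one = (noncrossingSetOperad M).one :=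
  rfl

theorem evalTree_comp {n m r : ℕ} (i : ℕ) (hi : i < n) (h : n + m = r + 1)
    (s : (setOperad (Triangles M)).obj n) (t : (setOperad (Triangles M)).obj m) :
    evalTree r ((setOperad (Triangles M)).comp i hi h s t) =
      (noncrossingSetOperad M).comp i hi h (evalTree n s) (evalTree m t) := by
  obtain ⟨s, rfl⟩ := s
  obtain ⟨t, rfl⟩ := t
  have := t.arity_pos
  obtain rfl : r = (s.graft i t).arity := by rw [arity_graft hi]; omega
  exact Subtype.ext (cliqueOfTree_graft s t hi _ rfl h)

/-- The function `lab` takes natural numbers as arguments, so the transport along the arity in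
`evalTree` does not affect it. -/
theorem lab_evalTree {n : ℕ} (t : SyntaxTree (Triangles M)) (ht : t.arity = n) (x y : ℕ) :
    (evalTree n ⟨t, ht⟩).1.lab x y = (cliqueOfTree t).lab x y := by
  subst ht
  rfl

theorem evalTree_surjective (n : ℕ) : Function.Surjective (evalTree (M := M) n) := by
  rintro ⟨p, hp⟩
  rw [Clique.noncrossing_iff] at hp
  -- Since `lab` is `1` outside the polygon, the noncrossing condition holds without a bound on the
  -- vertices.
  obtain ⟨t, ht, h₀, h₁⟩ := exists_tree_of_noncrossing p.lab (fun x y x' y' h₁ h₂ h₃ => by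
    by_cases hy : y' ≤ n
    · exact hp x y x' y' h₁ h₂ h₃ hy
    · exact Or.inr (by rw [Clique.lab, dif_neg (by omega)])) n 0 (p.lab 0 n) p.pos
    fun h => p.lab_of_one h _ _
  refine ⟨⟨t, ht⟩, Subtype.ext (Clique.lab_ext fun x y hxy hy => ?_)⟩
  rw [lab_evalTree]
  by_cases hb : x = 0 ∧ y = n
  · rw [hb.1, hb.2, h₀]
  · rw [h₁ x y hxy hy hb, zero_add, zero_add]

theorem evalTree_triangle (p : Triangles M 2) :
    evalTree 2 ⟨corolla Nat.two_pos p, arity_corolla _ _⟩ =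
      ⟨p.1, p.1.noncrossing_of_arity_two⟩ := by
  apply Subtype.ext
  apply Clique.lab_ext
  intro x y hxy hy
  rw [lab_evalTree]
  have hp : corolla Nat.two_pos p = bin (p.1.lab 0 2) (p.1.lab 0 1) (p.1.lab 1 2) leaf leaf := by
    rw [← corolla_triangle, ← p.eq_triangle]
  rw [hp, lab_cliqueOfTree_corolla _ _ _ hxy hy, ← p.eq_triangle]

variable (K : Type w) [Field K]

/-- The linear evaluation of the free operad on triangles in `NC M`. -/
noncomputable def evalLin (n : ℕ) : (freeOperad K (Triangles M)).obj n →ₗ[K] (NC K M).obj n :=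
  Finsupp.lmapDomain K K (evalTree n)

theorem evalLin_ofTree {n : ℕ} (t : SyntaxTree (Triangles M)) (ht : t.arity = n) :
    evalLin K n (freeOperad.ofTree K t ht) =
      (Finsupp.single (evalTree n ⟨t, ht⟩) 1 : (noncrossingSetOperad M).obj n →₀ K) :=
  Finsupp.mapDomain_single

theorem evalLin_ofTree_sub_ofTree_eq_zero_iff {n : ℕ} {s t : SyntaxTree (Triangles M)}
    (hs : s.arity = n) (ht : t.arity = n) :
    evalLin K n (freeOperad.ofTree K s hs - freeOperad.ofTree K t ht) = 0 ↔
      evalTree n ⟨s, hs⟩ = evalTree n ⟨t, ht⟩ := by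
  rw [map_sub, sub_eq_zero, evalLin_ofTree, evalLin_ofTree]
  exact (Finsupp.single_left_injective one_ne_zero).eq_iff

theorem evalLin_comp {n m r : ℕ} (i : ℕ) (hi : i < n) (h : n + m = r + 1)
    (x : (freeOperad K (Triangles M)).obj n) (y : (freeOperad K (Triangles M)).obj m) :
    evalLin K r ((freeOperad K (Triangles M)).comp i hi h x y) =
      (NC K M).comp i hi h (evalLin K n x) (evalLin K m y) :=
  NSSetOperad.lmapDomain_linComp K evalTree i hi h (evalTree_comp i hi h) x y

theorem evalLin_surjective (n : ℕ) : Function.Surjective (evalLin (M := M) K n) :=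
  Finsupp.mapDomain_surjective (evalTree_surjective n)

/-- The kernel of the evaluation, as an operad ideal. -/
noncomputable def evalKer (M : Type u) [MulOneClass M] :
    (freeOperad K (Triangles M)).Ideal where
  carrier n := LinearMap.ker (evalLin K n)
  comp_mem_left i hi h x y hx := by
    rw [LinearMap.mem_ker] at hx ⊢
    rw [evalLin_comp, hx, map_zero, LinearMap.zero_apply]
  comp_mem_right i hi h x y hy := by
    rw [LinearMap.mem_ker] at hy ⊢
    rw [evalLin_comp, hy, map_zero]

theorem ofTree_sub_ofTree_mem_ker {n : ℕ} {s t : SyntaxTree (Triangles M)} (hs : s.arity = n)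
    (ht : t.arity = n) (h : ∀ x y, x < y → y ≤ n →
      (cliqueOfTree s).lab x y = (cliqueOfTree t).lab x y) :
    freeOperad.ofTree K s hs - freeOperad.ofTree K t ht ∈ LinearMap.ker (evalLin K n) := by
  rw [LinearMap.mem_ker, evalLin_ofTree_sub_ofTree_eq_zero_iff]
  refine Subtype.ext (Clique.lab_ext fun x y hxy hy => ?_)
  rw [lab_evalTree, lab_evalTree, h x y hxy hy]

/-- In the first and third kinds of relation, the same diagonal of a square carries the same product
on both sides. In the second kind the two sides use different diagonals, and both diagonals are
labeled by `1` in either square. It remains to compare the six arcs. -/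
theorem relations_le_ker (n : ℕ) : relations K M n ≤ LinearMap.ker (evalLin K n) := by
  rw [relations, Submodule.span_le]
  rintro x ((⟨h, p₀, p₁, p₂, q₀, q₁, q₂, r₀, r₁, h₁, h₂, rfl⟩ |
    ⟨h, p₀, p₁, p₂, q₀, q₁, q₂, r₀, r₂, h₁, h₂, rfl⟩) |
    ⟨h, p₀, p₁, p₂, q₀, q₁, q₂, r₀, r₂, h₁, h₂, rfl⟩)
  all_goals
    simp only [triangleComp_zero, triangleComp_one]
    refine ofTree_sub_ofTree_mem_ker K _ _ fun x y hxy hy => ?_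
    have hy : y ≤ 3 := by omega
    obtain ⟨rfl, rfl⟩ | ⟨rfl, rfl⟩ | ⟨rfl, rfl⟩ | ⟨rfl, rfl⟩ | ⟨rfl, rfl⟩ | ⟨rfl, rfl⟩ :
      (x = 0 ∧ y = 1) ∨ (x = 0 ∧ y = 2) ∨ (x = 0 ∧ y = 3) ∨ (x = 1 ∧ y = 2) ∨
        (x = 1 ∧ y = 3) ∨ (x = 2 ∧ y = 3) := by omega
    all_goals
      simp [lab_cliqueOfTree_bin, lab_cliqueOfTree_corolla, lab_triangle, arity_bin, arity,
        cliqueOfTree, Clique.lab_unit, h₁, h₂]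

/-- Congruent trees have the same clique, so the normal forms of `s` and `t` share the common clique
of `s` and `t`, and uniqueness of the normal tree identifies them. -/
theorem treeCong_of_lab_eq {s t : SyntaxTree (Triangles M)} (har : s.arity = t.arity)
    (h : ∀ x y, x < y → y ≤ s.arity → (cliqueOfTree s).lab x y = (cliqueOfTree t).lab x y) :
    TreeCong K s t := by
  have hker : ∀ {s t : SyntaxTree (Triangles M)}, TreeCong K s t → s.arity = t.arity ∧
      ∀ x y, (cliqueOfTree s).lab x y = (cliqueOfTree t).lab x y := by
    rintro s t ⟨n, hs, ht, hmem⟩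
    refine ⟨hs.trans ht.symm, fun x y => ?_⟩
    simp only [NSOperad.Ideal.span, Submodule.mem_iInf] at hmem
    -- The kernel of the evaluation is one of the ideals whose intersection defines the generated
    -- ideal.
    have := hmem (evalKer K M) (relations_le_ker K)
    change _ ∈ LinearMap.ker (evalLin K n) at this
    rw [LinearMap.mem_ker, evalLin_ofTree_sub_ofTree_eq_zero_iff] at this
    rw [← lab_evalTree s hs, ← lab_evalTree t ht, this]
  obtain ⟨a, s', hs', hss⟩ := TreeCong.exists_isNormal (K := K) s
  obtain ⟨b, t', ht', htt⟩ := TreeCong.exists_isNormal (K := K) t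
  obtain ⟨hsa, hsl⟩ := hker hss
  obtain ⟨hta, htl⟩ := hker htt
  have hlab : ∀ x y, x < y → y ≤ s'.arity →
      (cliqueOfTree s').lab x y = (cliqueOfTree t').lab x y := fun x y hxy hy => by
    rw [← hsl, ← htl, h x y hxy (by omega)]
  have har' : s'.arity = t'.arity := by omega
  have hab : a = b := by
    rw [← hs'.lab_base, ← ht'.lab_base, hlab _ _ s'.arity_pos le_rfl, har']
  subst hab
  rw [hs'.eq_of_lab_eq ht' har' fun x y hxy hy _ => hlab x y hxy hy] at hss
  exact hss.trans htt.symm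

theorem span_relations_eq_ker (n : ℕ) :
    (NSOperad.Ideal.span (relations K M)).carrier n = LinearMap.ker (evalLin K n) := by
  apply le_antisymm
  · exact iInf₂_le (evalKer K M) (relations_le_ker K)
  · refine Finsupp.ker_lmapDomain_le K (evalTree_surjective n) _ ?_
    rintro ⟨s, rfl⟩ ⟨t, ht⟩ h
    obtain ⟨_, rfl, ht', hmem⟩ := treeCong_of_lab_eq K ht.symm fun x y _ _ => by
      rw [← lab_evalTree s rfl, ← lab_evalTree t ht, h]
    exact hmem

/-- The isomorphism from the quotient of the free operad on triangles onto `NC M`. -/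
noncomputable def presentationIso (M : Type u) [MulOneClass M] : NSOperad.Iso
    ((freeOperad K (Triangles M)).quotient (NSOperad.Ideal.span (relations K M))) (NC K M) where
  equiv n := (Submodule.quotEquivOfEq _ _ (span_relations_eq_ker K n)).trans
    ((evalLin K n).quotKerEquivOfSurjective (evalLin_surjective K n))
  map_one := by
    change evalLin K 1 (freeOperad K (Triangles M)).one = _
    exact Finsupp.mapDomain_single.trans (by rw [evalTree_one]; rfl)
  map_comp i hi h x y := by
    obtain ⟨x, rfl⟩ := Submodule.Quotient.mk_surjective _ x
    obtain ⟨y, rfl⟩ := Submodule.Quotient.mk_surjective _ y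
    exact evalLin_comp K i hi h x y

theorem isQuadraticSpace_relations (M : Type u) [MulOneClass M] :
    NSOperad.IsQuadraticSpace (relations K M) := by
  intro n
  rw [relations, Submodule.span_le]
  rintro x ((⟨h, p₀, p₁, p₂, q₀, q₁, q₂, r₀, r₁, -, -, rfl⟩ |
    ⟨h, p₀, p₁, p₂, q₀, q₁, q₂, r₀, r₂, -, -, rfl⟩) |
    ⟨h, p₀, p₁, p₂, q₀, q₁, q₂, r₀, r₂, -, -, rfl⟩)
  all_goals
    simp only [triangleComp_zero, triangleComp_one]
    refine sub_mem (Submodule.subset_span ⟨_, _, ?_, rfl⟩) (Submodule.subset_span ⟨_, _, ?_, rfl⟩)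
    all_goals simp [degree_bin, degree]

end Evaluation

theorem mainTheorem1 (K : Type w) [Field K] [CharZero K] (M : Type u) [MulOneClass M] [Finite M] :
    (NC K M).IsPresentation (Triangles M) (relations K M) ∧
    (∃ φ : NSOperad.Iso
        ((freeOperad K (Triangles M)).quotient (NSOperad.Ideal.span (relations K M))) (NC K M),
      ∀ p : Triangles M 2,
        φ.equiv 2 (NSOperad.toQuotient (NSOperad.Ideal.span (relations K M))
          (freeOperad.c K Nat.two_pos p)) = NC.basis K p.1 p.1.noncrossing_of_arity_two) ∧
    (∀ n, n ≠ 2 → IsEmpty (Triangles M n)) ∧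
    NSOperad.IsQuadraticSpace (relations K M) ∧
    NSOperad.IsBinary.{u} (NC K M) ∧
    NSOperad.IsQuadratic.{u} (NC K M) := by
  have hG : ∀ n, n ≠ 2 → IsEmpty (Triangles M n) := fun n hn => ⟨fun p => hn p.2⟩
  have hP : (NC K M).IsPresentation (Triangles M) (relations K M) := ⟨presentationIso K M⟩
  have hQ := isQuadraticSpace_relations K M
  refine ⟨hP, ⟨presentationIso K M, fun p => ?_⟩, hG, hQ, ⟨_, _, hP, hG⟩, ⟨_, _, hP, hQ⟩⟩
  -- On classes, the isomorphism is by definition the linear evaluation.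
  change evalLin K 2 (freeOperad.c K Nat.two_pos p) = _
  exact (evalLin_ofTree K _ _).trans (by rw [evalTree_triangle]; rfl)
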